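/- Let $G$ be a finite group acting by $*$-automorphisms $\alpha=(\alpha_g)_{g\in G}$ on a unital C*-algebra $A$. Let $A\rtimes_\alpha G$ be the crossed product, i.e. the universal C*-algebra generated by a copy of $A$ and unitaries $U^g$ ($g\in G$) with $U^{gh}=U^gU^h$ and $U^g a (U^{g})^{*}=\alpha_g(a)$. A representation is a unital $*$-homomorphism into the bounded operators on a Hilbert space; it is irreducible if the space is nonzero and has no nontrivial closed invariant subspace. Two representations are disjoint if no nonzero subrepresentation of one is unitarily equivalent to a subrepresentation of the other. A unitary projective representation of a group $K$ is a map $\Lambda$ from $K$ to the unitaries of a Hilbert space with $\Lambda_{gh}=\sigma(g,h)\Lambda_g\Lambda_h$ for some $2$-cocycle $\sigma:K\times K\to\mathbb{T}$; it is irreducible if the space is nonzero and has no nontrivial closed subspace invariant under all $\Lambda_g$. Let $\Pi$ be an irreducible representation of $A\rtimes_\alpha G$ on a Hilbert space $\mathcal H$. Then there exist a subgroup $H$ of $G$, of index $m=[G:H]$, an irreducible representation $\pi_1$ of $A$ on a Hilbert space $\mathcal H_1$, an integer $r\ge 1$, the representation $\pi=1_{\mathbb C^r}\otimes\pi_1$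 of $A$ on $\mathcal J=\mathbb C^r\otimes\mathcal H_1$, maps $h\mapsto V^h$ and $h\mapsto\Lambda_h$ from $H$ to the unitaries of $\mathcal H_1$ and of $\mathbb C^r$, a representation $\Psi$ of $A\rtimes_\alpha H$ on $\mathcal J$, and, for each $g\in G$, an isometric copy $\mathcal J_g\subseteq\mathcal H$ of $\mathcal J$ (the range of a linear isometry $T_g:\mathcal J\to\mathcal H$), such that: (a) $H=\{g\in G:\pi_1\circ\alpha_g\text{ is unitarily equivalent to }\pi_1\}$; (b) $V$ is a unitary projective representation of $H$, and $V^h\pi_1(a)(V^h)^*=\pi_1(\alpha_h(a))$ for all $h\in H$, $a\in A$; (c) $\Lambda$ is an irreducible unitary projective representation of $H$ on $\mathbb C^r$; (d) $\Psi$ is irreducible, $\Psi(a)=\pi(a)$ for $a\in A$ and $\Psi(U^h)=\Lambda_h\otimes V^h$ for $h\in H$; (e) for every family $g_1,\dots,g_m$ in $G$ with $g_1$ the neutral element, such that the right cosets $Hg_1,\dots,Hg_m$ are pairwise disjoint and cover $G$: 1. for $i\ne j$ the representations $\pi\circ\alpha_{g_i}$ and $\pi\circ\alpha_{g_j}$ are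 disjoint (in particular not unitarily equivalent); 2. $\mathcal H=\mathcal J_{g_1}\oplus\dots\oplus\mathcal J_{g_m}$ (orthogonal direct sum), and in this decomposition, each $\mathcal J_{g_i}$ being identified with $\mathcal J$ through $T_{g_i}$, $\Pi(a)=\pi\circ\alpha_{g_1}(a)\oplus\dots\oplus\pi\circ\alpha_{g_m}(a)$ for all $a\in A$; 3. for every $g\in G$ there are a permutation $\sigma^g$ of $\{1,\dots,m\}$ and unitaries $U^g_i:\mathcal J_{g_i}\to\mathcal J_{g_{\sigma^g(i)}}$ such that in the same decomposition $\Pi(U^g)$ is the matrix whose $(i,j)$ entry is $U^g_j$ if $i=\sigma^g(j)$ and $0$ otherwise; moreover $H=\{g\in G:\sigma^g(1)=1\}$, and $U^h_1=\Psi(U^h)$ for all $h\in H$. -/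

import Mathlib

open scoped TensorProduct

universe u v w

section Completeness

/-- The (algebraic) tensor product of `ℂ ^ r` with a Hilbert space, with its usual inner product,
is a Hilbert space: it is isometric to the direct sum of `r` copies. -/
theorem exists_linearIsometryEquiv_piLp_tensor (r : ℕ) (E : Type*) [NormedAddCommGroup E]
    [InnerProductSpace ℂ E] :
    ∃ T : PiLp 2 (fun _ : Fin r => E) ≃ₗᵢ[ℂ] (EuclideanSpace ℂ (Fin r) ⊗[ℂ] E),
      ∀ y, T y = ∑ i, EuclideanSpace.single i (1 : ℂ) ⊗ₜ[ℂ] y i := by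
  classical
  let L : PiLp 2 (fun _ : Fin r => E) →ₗ[ℂ] (EuclideanSpace ℂ (Fin r) ⊗[ℂ] E) :=
    { toFun := fun y => ∑ i, EuclideanSpace.single i (1 : ℂ) ⊗ₜ[ℂ] y i
      map_add' := fun x y => by simp [TensorProduct.tmul_add, Finset.sum_add_distrib]
      map_smul' := fun c x => by simp [TensorProduct.tmul_smul, Finset.smul_sum] }
  have hL : ∀ y, L y = ∑ i, EuclideanSpace.single i (1 : ℂ) ⊗ₜ[ℂ] y i := fun _ => rfl
  have hinner : ∀ x y, inner ℂ (L x) (L y) = inner ℂ x y := by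
    intro x y
    rw [hL, hL, sum_inner, PiLp.inner_apply]
    refine Finset.sum_congr rfl fun i _ => ?_
    rw [inner_sum, Finset.sum_eq_single i]
    · simp [TensorProduct.inner_tmul]
    · intro j _ hj
      simp [TensorProduct.inner_tmul, EuclideanSpace.inner_single_left, hj.symm]
    · simp
  let I : PiLp 2 (fun _ : Fin r => E) →ₗᵢ[ℂ] (EuclideanSpace ℂ (Fin r) ⊗[ℂ] E) :=
    L.isometryOfInner hinner
  have hI : ∀ y, I y = ∑ i, EuclideanSpace.single i (1 : ℂ) ⊗ₜ[ℂ] y i := fun _ => rfl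
  have hsurj : Function.Surjective I := by
    intro z
    induction z using TensorProduct.induction_on with
    | zero => exact ⟨0, map_zero I⟩
    | add x y hx hy =>
      obtain ⟨a, rfl⟩ := hx
      obtain ⟨b, rfl⟩ := hy
      exact ⟨a + b, map_add I a b⟩
    | tmul v x =>
      refine ⟨WithLp.toLp 2 fun i => v i • x, ?_⟩
      rw [hI]
      conv_rhs => rw [← (EuclideanSpace.basisFun (Fin r) ℂ).sum_repr v]
      simp [TensorProduct.sum_tmul, TensorProduct.smul_tmul]
  exact ⟨LinearIsometryEquiv.ofSurjective I hsurj, fun y => rfl⟩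

instance instCompleteSpaceEuclideanTensor (r : ℕ) (E : Type*) [NormedAddCommGroup E]
    [InnerProductSpace ℂ E] [CompleteSpace E] :
    CompleteSpace (EuclideanSpace ℂ (Fin r) ⊗[ℂ] E) := by
  obtain ⟨T, -⟩ := exists_linearIsometryEquiv_piLp_tensor r E
  exact (completeSpace_congr (e := T.toEquiv) T.isometry.isUniformEmbedding).1 inferInstance

/-- The Hilbert space tensor product `ℂ ^ r ⊗ E`. -/
abbrev CTensor (r : ℕ) (E : Type*) [NormedAddCommGroup E] [InnerProductSpace ℂ E] : Type _ :=
  EuclideanSpace ℂ (Fin r) ⊗[ℂ] E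

end Completeness

/-! ### The crossed product `A ⋊_α G` of a unital C⋆-algebra by a finite group -/

section CrossedProduct

attribute [local instance] CStarAlgebra.spectralOrder CStarAlgebra.spectralOrderedRing
attribute [local instance] Fintype.ofFinite Classical.propDecidable

namespace CrossedProduct

/-- For `a : A`, the diagonal `G × G` matrix with `s`-th diagonal entry `α_{s⁻¹}(a)`. -/
noncomputable def diagMatrix {G A : Type*} [Group G] [Finite G] [CStarAlgebra A]
    (α : G →* (A ≃⋆ₐ[ℂ] A)) (a : A) : CStarMatrix G G A :=
  CStarMatrix.ofMatrix (Matrix.of fun s t => if s = t then α s⁻¹ a else 0)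

/-- For `g : G`, the permutation matrix of the left translation by `g`. -/
noncomputable def shiftMatrix {G : Type*} (A : Type*) [Group G] [Finite G] [CStarAlgebra A]
    (g : G) : CStarMatrix G G A :=
  CStarMatrix.ofMatrix (Matrix.of fun s t => if s = g * t then 1 else 0)

/-- The C⋆-subalgebra of `M_G(A)` generated by the diagonal copy of `A` and by the translation
matrices. -/
noncomputable def matrixSubalgebra {G A : Type*} [Group G] [Finite G] [CStarAlgebra A]
    (α : G →* (A ≃⋆ₐ[ℂ] A)) : StarSubalgebra ℂ (CStarMatrix G G A) :=
  (StarAlgebra.adjoin ℂ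
    (Set.range (diagMatrix α) ∪ Set.range (shiftMatrix (G := G) A))).topologicalClosure

end CrossedProduct

/-- The crossed product `A ⋊_α G` of a unital C⋆-algebra `A` by an action `α` of a finite group
`G` by ⋆-automorphisms, realised on `G` copies of `A`. It is generated by the covariant pair
`CrossedProduct.ι`, `CrossedProduct.U`, and it is universal for covariant pairs
(`CrossedProduct.existsUnique_lift`). -/
def CrossedProduct {G A : Type*} [Group G] [Finite G] [CStarAlgebra A]
    (α : G →* (A ≃⋆ₐ[ℂ] A)) : Type _ :=
  ↥(CrossedProduct.matrixSubalgebra α)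

namespace CrossedProduct

noncomputable instance instCStarAlgebra {G A : Type*} [Group G] [Finite G] [CStarAlgebra A]
    (α : G →* (A ≃⋆ₐ[ℂ] A)) : CStarAlgebra (CrossedProduct α) :=
  StarSubalgebra.cstarAlgebra (matrixSubalgebra α)
    (h_closed := StarSubalgebra.isClosed_topologicalClosure _)

/-- The inclusion of the crossed product into the matrices over `A`. -/
noncomputable def toMatrix {G A : Type*} [Group G] [Finite G] [CStarAlgebra A]
    (α : G →* (A ≃⋆ₐ[ℂ] A)) : CrossedProduct α →⋆ₐ[ℂ] CStarMatrix G G A :=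
  (matrixSubalgebra α).subtype

theorem toMatrix_injective {G A : Type*} [Group G] [Finite G] [CStarAlgebra A]
    (α : G →* (A ≃⋆ₐ[ℂ] A)) : Function.Injective (toMatrix α) :=
  Subtype.val_injective

/-- The diagonal representation, as a ⋆-homomorphism. -/
noncomputable def diagHom {G A : Type*} [Group G] [Finite G] [CStarAlgebra A]
    (α : G →* (A ≃⋆ₐ[ℂ] A)) : A →⋆ₐ[ℂ] CStarMatrix G G A where
  toFun := diagMatrix α
  map_one' := by
    ext s t; simp [diagMatrix, CStarMatrix.one_apply]
  map_mul' a b := by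
    ext s t
    simp only [CStarMatrix.mul_apply, diagMatrix, CStarMatrix.ofMatrix_apply, Matrix.of_apply]
    rw [Finset.sum_eq_single s] <;> simp +contextual [eq_comm]
  map_zero' := by
    ext s t; simp [diagMatrix]
  map_add' a b := by
    ext s t; simp only [diagMatrix, CStarMatrix.add_apply, CStarMatrix.ofMatrix_apply,
      Matrix.of_apply]; split_ifs <;> simp
  commutes' c := by
    ext s t
    simp only [diagMatrix, CStarMatrix.algebraMap_apply, CStarMatrix.ofMatrix_apply,
      Matrix.of_apply, Algebra.algebraMap_eq_smul_one]
    split_ifs <;> simp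
  map_star' a := by
    ext s t
    simp only [diagMatrix, CStarMatrix.star_apply, CStarMatrix.ofMatrix_apply, Matrix.of_apply]
    by_cases h : s = t
    · subst h; simp [map_star]
    · simp [h, Ne.symm h]

theorem shiftMatrix_one (G A : Type*) [Group G] [Finite G] [CStarAlgebra A] :
    shiftMatrix A (1 : G) = 1 := by
  ext s t; simp [shiftMatrix, CStarMatrix.one_apply]

theorem shiftMatrix_mul {G A : Type*} [Group G] [Finite G] [CStarAlgebra A] (g h : G) :
    shiftMatrix A (g * h) = shiftMatrix A g * shiftMatrix A h := by
  ext s t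
  simp only [CStarMatrix.mul_apply, shiftMatrix, CStarMatrix.ofMatrix_apply, Matrix.of_apply]
  rw [Finset.sum_eq_single (h * t)]
  · simp [mul_assoc]
  · intro x _ hx; simp [hx]
  · simp

theorem star_shiftMatrix {G A : Type*} [Group G] [Finite G] [CStarAlgebra A] (g : G) :
    star (shiftMatrix A g) = shiftMatrix A g⁻¹ := by
  ext s t
  simp only [CStarMatrix.star_apply, shiftMatrix, CStarMatrix.ofMatrix_apply, Matrix.of_apply]
  have : t = g * s ↔ s = g⁻¹ * t := by rw [eq_inv_mul_iff_mul_eq, eq_comm]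
  by_cases h : s = g⁻¹ * t
  · rw [if_pos h, if_pos (this.2 h), star_one]
  · rw [if_neg h, if_neg (fun h' => h (this.1 h')), star_zero]

theorem diagMatrix_mem {G A : Type*} [Group G] [Finite G] [CStarAlgebra A]
    (α : G →* (A ≃⋆ₐ[ℂ] A)) (a : A) : diagMatrix α a ∈ matrixSubalgebra α :=
  StarSubalgebra.le_topologicalClosure _ (StarAlgebra.subset_adjoin ℂ _ (Or.inl ⟨a, rfl⟩))

theorem shiftMatrix_mem {G A : Type*} [Group G] [Finite G] [CStarAlgebra A]
    (α : G →* (A ≃⋆ₐ[ℂ] A)) (g : G) : shiftMatrix A g ∈ matrixSubalgebra α :=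
  StarSubalgebra.le_topologicalClosure _ (StarAlgebra.subset_adjoin ℂ _ (Or.inr ⟨g, rfl⟩))

/-- The canonical embedding of `A` in `A ⋊_α G`. -/
noncomputable def ι {G A : Type*} [Group G] [Finite G] [CStarAlgebra A]
    (α : G →* (A ≃⋆ₐ[ℂ] A)) : A →⋆ₐ[ℂ] CrossedProduct α :=
  StarAlgHom.codRestrict (diagHom α) (matrixSubalgebra α) (diagMatrix_mem α)

/-- The translation matrix of `g`, as an element of the crossed product. -/
noncomputable def shiftElement {G A : Type*} [Group G] [Finite G] [CStarAlgebra A]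
    (α : G →* (A ≃⋆ₐ[ℂ] A)) (g : G) : CrossedProduct α :=
  (⟨shiftMatrix A g, shiftMatrix_mem α g⟩ : matrixSubalgebra α)

/-- The canonical unitaries `U^g` of `A ⋊_α G`. -/
noncomputable def U {G A : Type*} [Group G] [Finite G] [CStarAlgebra A]
    (α : G →* (A ≃⋆ₐ[ℂ] A)) : G →* unitary (CrossedProduct α) where
  toFun g := ⟨shiftElement α g, by
    refine Unitary.mem_iff.2 ⟨toMatrix_injective α ?_, toMatrix_injective α ?_⟩
    · rw [map_mul, map_star, map_one]
      change star (shiftMatrix A g) * shiftMatrix A g = 1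
      rw [star_shiftMatrix, ← shiftMatrix_mul, inv_mul_cancel, shiftMatrix_one]
    · rw [map_mul, map_star, map_one]
      change shiftMatrix A g * star (shiftMatrix A g) = 1
      rw [star_shiftMatrix, ← shiftMatrix_mul, mul_inv_cancel, shiftMatrix_one]⟩
  map_one' := Subtype.ext (Subtype.ext (shiftMatrix_one G A))
  map_mul' g h := Subtype.ext (Subtype.ext (shiftMatrix_mul g h))

theorem toMatrix_ι {G A : Type*} [Group G] [Finite G] [CStarAlgebra A]
    (α : G →* (A ≃⋆ₐ[ℂ] A)) (a : A) : toMatrix α (ι α a) = diagMatrix α a := rfl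

theorem toMatrix_U {G A : Type*} [Group G] [Finite G] [CStarAlgebra A]
    (α : G →* (A ≃⋆ₐ[ℂ] A)) (g : G) :
    toMatrix α (U α g : CrossedProduct α) = shiftMatrix A g := rfl

theorem toMatrix_ι_mul_U_apply {G A : Type*} [Group G] [Finite G] [CStarAlgebra A]
    (α : G →* (A ≃⋆ₐ[ℂ] A)) (a : A) (g s t : G) :
    toMatrix α (ι α a * (U α g : CrossedProduct α)) s t = if s = g * t then α s⁻¹ a else 0 := by
  rw [map_mul, toMatrix_ι, toMatrix_U]
  simp only [CStarMatrix.mul_apply, shiftMatrix, diagMatrix, CStarMatrix.ofMatrix_apply,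
    Matrix.of_apply]
  rw [Finset.sum_eq_single s]
  · simp
  · intro x _ hx; simp [Ne.symm hx]
  · simp

/-- The pair `(ι, U)` is covariant. -/
theorem covariant {G A : Type*} [Group G] [Finite G] [CStarAlgebra A]
    (α : G →* (A ≃⋆ₐ[ℂ] A)) (g : G) (a : A) :
    (U α g : CrossedProduct α) * ι α a * star (U α g : CrossedProduct α) = ι α (α g a) := by
  have h : (U α g : CrossedProduct α) * ι α a = ι α (α g a) * (U α g : CrossedProduct α) := by
    apply toMatrix_injective α
    ext s t
    rw [toMatrix_ι_mul_U_apply, map_mul, toMatrix_ι, toMatrix_U]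
    simp only [CStarMatrix.mul_apply, shiftMatrix, diagMatrix, CStarMatrix.ofMatrix_apply,
      Matrix.of_apply]
    rw [Finset.sum_eq_single t]
    · by_cases hs : s = g * t
      · subst hs
        simp [← StarAlgEquiv.mul_apply, ← map_mul]
      · simp [hs]
    · intro x _ hx; simp [hx]
    · simp
  rw [h, mul_assoc, Unitary.mul_star_self_of_mem (U α g).2, mul_one]

theorem map_mul_apply {G A : Type*} [Group G] [CStarAlgebra A]
    (α : G →* (A ≃⋆ₐ[ℂ] A)) (g h : G) (a : A) : α g (α h a) = α (g * h) a := by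
  rw [map_mul, StarAlgEquiv.mul_apply]

/-- The matrices in the crossed product are fixed by the diagonal action of `G`. -/
theorem toMatrix_apply_eq {G A : Type*} [Group G] [Finite G] [CStarAlgebra A]
    (α : G →* (A ≃⋆ₐ[ℂ] A)) (b : CrossedProduct α) (s t u : G) :
    toMatrix α b s t = α u (toMatrix α b (s * u) (t * u)) := by
  let F : StarSubalgebra ℂ (CStarMatrix G G A) :=
    { carrier := {M | ∀ s t u : G, M s t = α u (M (s * u) (t * u))}
      mul_mem' := fun {M N} hM hN s t u => by
        simp only [CStarMatrix.mul_apply, map_sum, map_mul]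
        refine Eq.trans (Finset.sum_congr rfl fun x _ => ?_) (Equiv.sum_comp (Equiv.mulRight u)
          fun x => α u (M (s * u) x) * α u (N x (t * u)))
        exact congrArg₂ (· * ·) (hM s x u) (hN x t u)
      add_mem' := fun {M N} hM hN s t u => by
        simp only [CStarMatrix.add_apply, map_add]; rw [hM s t u, hN s t u]
      algebraMap_mem' := fun c s t u => by
        simp only [CStarMatrix.algebraMap_apply, Algebra.algebraMap_eq_smul_one]
        by_cases h : s = t <;> simp [h]
      star_mem' := fun {M} hM s t u => by
        simp only [CStarMatrix.star_apply, map_star]; rw [hM t s u] }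
  have hcl : IsClosed (F : Set (CStarMatrix G G A)) := by
    have : (F : Set (CStarMatrix G G A)) =
        ⋂ (s : G) (t : G) (u : G), {M | M s t = α u (M (s * u) (t * u))} := by
      ext M; simp [F]
    rw [this]
    have hc : ∀ s t : G, Continuous fun M : CStarMatrix G G A => M s t := fun s t =>
      (continuous_apply t).comp (continuous_apply (A := fun _ : G => G → A) s)
    exact isClosed_iInter fun s => isClosed_iInter fun t => isClosed_iInter fun u =>
      isClosed_eq (hc s t) ((StarAlgEquiv.isometry (α u)).continuous.comp (hc _ _))
  have hle : matrixSubalgebra α ≤ F := by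
    refine StarSubalgebra.topologicalClosure_minimal (StarAlgebra.adjoin_le ?_) hcl
    rintro _ (⟨a, rfl⟩ | ⟨g, rfl⟩)
    · intro s t u
      by_cases h : s = t
      · subst h
        simp only [diagMatrix, CStarMatrix.ofMatrix_apply, Matrix.of_apply, if_true]
        rw [map_mul_apply, mul_inv_rev, mul_inv_cancel_left]
      · simp [diagMatrix, h]
    · intro s t u
      by_cases h : s = g * t
      · subst h
        simp [shiftMatrix, mul_assoc]
      · simp [shiftMatrix, h, ← mul_assoc]
  exact hle b.2 s t u

/-- The coefficient of `b` at `U^g`. -/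
noncomputable def coeff {G A : Type*} [Group G] [Finite G] [CStarAlgebra A]
    (α : G →* (A ≃⋆ₐ[ℂ] A)) (b : CrossedProduct α) (g : G) : A :=
  α g (toMatrix α b g 1)

/-- `A ⋊_α G = ⨁_g A U^g`. -/
theorem eq_sum_coeff {G A : Type*} [Group G] [Fintype G] [CStarAlgebra A]
    (α : G →* (A ≃⋆ₐ[ℂ] A)) (b : CrossedProduct α) :
    b = ∑ g, ι α (coeff α b g) * (U α g : CrossedProduct α) := by
  apply toMatrix_injective α
  ext s t
  rw [map_sum]
  have hsum : ∀ f : G → CStarMatrix G G A, (∑ g, f g) s t = ∑ g, f g s t := fun f =>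
    (congrFun (Finset.sum_apply (M := fun _ : G => G → A) s _ _) t).trans
      (Finset.sum_apply (M := fun _ : G => A) t _ _)
  rw [hsum, Finset.sum_eq_single (s * t⁻¹)]
  · rw [toMatrix_ι_mul_U_apply, if_pos (by group), coeff, ← StarAlgEquiv.mul_apply, ← map_mul,
      toMatrix_apply_eq α b s t t⁻¹]
    simp
  · intro g _ hg
    rw [toMatrix_ι_mul_U_apply, if_neg]
    rintro rfl
    exact hg (by group)
  · simp

/-- The universal property: every covariant pair `(ρ, u)` in a unital ⋆-algebra (in particular,
in a unital C⋆-algebra) factors uniquely through `A ⋊_α G`. -/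
theorem existsUnique_lift {G A B : Type*} [Group G] [Finite G] [CStarAlgebra A]
    [Ring B] [Algebra ℂ B] [StarRing B]
    (α : G →* (A ≃⋆ₐ[ℂ] A)) (ρ : A →⋆ₐ[ℂ] B) (u : G →* unitary B)
    (hu : ∀ g a, (u g : B) * ρ a * star (u g : B) = ρ (α g a)) :
    ∃! Φ : CrossedProduct α →⋆ₐ[ℂ] B,
      (∀ a, Φ (ι α a) = ρ a) ∧ ∀ g, Φ (U α g : CrossedProduct α) = u g := by
  have hu' : ∀ g a, (u g : B) * ρ a = ρ (α g a) * (u g : B) := fun g a => by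
    rw [← hu, mul_assoc, Unitary.star_mul_self_of_mem (u g).2, mul_one]
  have cmul : ∀ (b c : CrossedProduct α) (g : G),
      coeff α (b * c) g = ∑ t, coeff α b (g * t⁻¹) * α (g * t⁻¹) (coeff α c t) := by
    intro b c g
    simp only [coeff]
    rw [map_mul (toMatrix α), CStarMatrix.mul_apply, map_sum]
    refine Finset.sum_congr rfl fun t _ => ?_
    rw [map_mul]
    rw [toMatrix_apply_eq α b g t t⁻¹, map_mul_apply, map_mul_apply, mul_inv_cancel,
      inv_mul_cancel_right]
  have cstar : ∀ (b : CrossedProduct α) (g : G),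
      coeff α (star b) g = star (α g (coeff α b g⁻¹)) := by
    intro b g
    simp only [coeff, map_star, CStarMatrix.star_apply]
    rw [toMatrix_apply_eq α b 1 g g⁻¹]
    simp
  let f : CrossedProduct α → B := fun b => ∑ g, ρ (coeff α b g) * (u g : B)
  have fι : ∀ a, f (ι α a) = ρ a := by
    intro a
    simp only [f]
    rw [Finset.sum_eq_single 1]
    · simp [coeff, toMatrix_ι, diagMatrix]
    · intro g _ hg
      simp [coeff, toMatrix_ι, diagMatrix, hg]
    · simp
  have fU : ∀ g, f (U α g : CrossedProduct α) = u g := by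
    intro g
    simp only [f]
    rw [Finset.sum_eq_single g]
    · simp [coeff, toMatrix_U, shiftMatrix]
    · intro h _ hg
      simp [coeff, toMatrix_U, shiftMatrix, hg]
    · simp
  have fmul : ∀ b c, f (b * c) = f b * f c := by
    intro b c
    simp only [f]
    simp only [cmul, map_sum, Finset.sum_mul, Finset.mul_sum, map_mul ρ]
    rw [Finset.sum_comm]
    refine Finset.sum_congr rfl fun t _ => ?_
    rw [← Equiv.sum_comp (Equiv.mulRight t)]
    refine Finset.sum_congr rfl fun g _ => ?_
    simp only [Equiv.coe_mulRight, mul_inv_cancel_right]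
    rw [map_mul u, Submonoid.coe_mul, mul_assoc, ← mul_assoc (ρ (α g _)), ← hu']
    simp only [mul_assoc]
  have fstar : ∀ b, f (star b) = star (f b) := by
    intro b
    simp only [f, star_sum, star_mul]
    rw [← Equiv.sum_comp (Equiv.inv G)]
    refine Finset.sum_congr rfl fun g _ => ?_
    simp only [Equiv.inv_apply, cstar, inv_inv, map_star]
    rw [← hu]
    have : ((u g⁻¹ : unitary B) : B) = star (u g : B) := by
      rw [map_inv]; rfl
    rw [this]
    simp [mul_assoc]
  have hlin : ∀ (c : ℂ) (b : CrossedProduct α), f (c • b) = c • f b := by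
    intro c b
    simp [f, coeff, Finset.smul_sum]
  let Φ : CrossedProduct α →⋆ₐ[ℂ] B :=
    { toFun := f
      map_one' := by have := fι 1; rwa [map_one, map_one] at this
      map_mul' := fmul
      map_zero' := by simp [f, coeff]
      map_add' := fun b c => by simp [f, coeff, add_mul, Finset.sum_add_distrib]
      commutes' := fun c => by
        have := fι 1; rw [map_one, map_one] at this
        rw [Algebra.algebraMap_eq_smul_one, hlin, this, Algebra.algebraMap_eq_smul_one]
      map_star' := fstar }
  refine ⟨Φ, ⟨fι, fU⟩, ?_⟩
  rintro Θ ⟨hΘι, hΘU⟩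
  ext b
  change Θ b = f b
  conv_lhs => rw [eq_sum_coeff α b]
  simp only [map_sum, map_mul, hΘι, hΘU, f]

end CrossedProduct

end CrossedProduct

/-! ### Representations on Hilbert spaces -/

section Representations

/-- A set `S` of bounded operators on a Hilbert space is irreducible if the space is nonzero and
its only closed `S`-invariant subspaces are `0` and the whole space. -/
def IsIrreducibleSet {E : Type*} [NormedAddCommGroup E] [InnerProductSpace ℂ E]
    (S : Set (E →L[ℂ] E)) : Prop :=
  Nontrivial E ∧ ∀ K : Submodule ℂ E, IsClosed (K : Set E) →
    (∀ T ∈ S, ∀ x ∈ K, T x ∈ K) → K = ⊥ ∨ K = ⊤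

/-- Irreducible (unital ⋆-)representations of a unital C⋆-algebra. -/
def IsIrreducibleRep {A E : Type*} [CStarAlgebra A] [NormedAddCommGroup E]
    [InnerProductSpace ℂ E] [CompleteSpace E] (π : A →⋆ₐ[ℂ] (E →L[ℂ] E)) : Prop :=
  IsIrreducibleSet (Set.range π)

/-- Unitary equivalence of representations. -/
def UnitarilyEquivalent {A E F : Type*} [CStarAlgebra A]
    [NormedAddCommGroup E] [InnerProductSpace ℂ E] [CompleteSpace E]
    [NormedAddCommGroup F] [InnerProductSpace ℂ F] [CompleteSpace F]
    (π : A →⋆ₐ[ℂ] (E →L[ℂ] E)) (ρ : A →⋆ₐ[ℂ] (F →L[ℂ] F)) : Prop :=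
  ∃ W : E ≃ₗᵢ[ℂ] F, ∀ a x, W (π a x) = ρ a (W x)

/-- Disjointness of representations: no nonzero subrepresentation of `π` (on a closed invariant
subspace `K`) is unitarily equivalent to a subrepresentation of `ρ` (on a closed invariant
subspace `L`). -/
def DisjointReps {A E F : Type*} [CStarAlgebra A]
    [NormedAddCommGroup E] [InnerProductSpace ℂ E] [CompleteSpace E]
    [NormedAddCommGroup F] [InnerProductSpace ℂ F] [CompleteSpace F]
    (π : A →⋆ₐ[ℂ] (E →L[ℂ] E)) (ρ : A →⋆ₐ[ℂ] (F →L[ℂ] F)) : Prop :=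
  ∀ (K : Submodule ℂ E) (L : Submodule ℂ F), IsClosed (K : Set E) → IsClosed (L : Set F) →
    ∀ (hK : ∀ a, ∀ x ∈ K, π a x ∈ K), (∀ a, ∀ y ∈ L, ρ a y ∈ L) → K ≠ ⊥ →
      ¬ ∃ W : K ≃ₗᵢ[ℂ] L, ∀ a (x : K), (W ⟨π a x, hK a x x.2⟩ : F) = ρ a (W x : F)

/-- The representation `π ∘ α_g`. -/
noncomputable def twist {G A E : Type*} [Group G] [CStarAlgebra A] [NormedAddCommGroup E]
    [InnerProductSpace ℂ E] [CompleteSpace E] (π : A →⋆ₐ[ℂ] (E →L[ℂ] E))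
    (α : G →* (A ≃⋆ₐ[ℂ] A)) (g : G) : A →⋆ₐ[ℂ] (E →L[ℂ] E) :=
  π.comp (α g : A →⋆ₐ[ℂ] A)

/-- A map `Λ` from a group to the unitary operators of a Hilbert space is a unitary projective
representation if there is a `2`-cocycle `σ` with `Λ_{gh} = σ(g, h) Λ_g Λ_h`. -/
def IsUnitaryProjectiveRep {K E : Type*} [Group K] [NormedAddCommGroup E]
    [InnerProductSpace ℂ E] [CompleteSpace E] (Λ : K → unitary (E →L[ℂ] E)) : Prop :=
  ∃ σ : K → K → Circle,
    (∀ g h k, σ g h * σ (g * h) k = σ h k * σ g (h * k)) ∧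
    ∀ g h, (Λ (g * h) : E →L[ℂ] E) =
      (σ g h : ℂ) • ((Λ g : E →L[ℂ] E) * (Λ h : E →L[ℂ] E))

/-- The family `g` is a system of representatives of the right cosets `H x` of `H`. -/
def IsRightCosetReps {G I : Type*} [Group G] (H : Subgroup G) (g : I → G) : Prop :=
  (Pairwise fun i j => Disjoint {x | ∃ h ∈ H, x = h * g i} {x | ∃ h ∈ H, x = h * g j}) ∧
    ⋃ i, {x | ∃ h ∈ H, x = h * g i} = Set.univ

end Representations

/-!
Restrict the irreducible representation `P` of `A ⋊ G` to `A` and write `ρ` for the restriction,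
`U` for the unitaries implementing the action. For an operator `T` commuting with `ρ`, the mean
`∑ U_g T U_g*` commutes with everything, so by Schur's lemma it is a scalar. Applied to the
projection onto a closed `ρ`-invariant subspace this scalar is at least `1`, and it drops by at
least `1` when the subspace shrinks. Hence minimal invariant subspaces exist, giving an irreducible
`π₁ ⊆ ρ` (`IsIrreducibleCovariantPair.exists_minimal_subspace`); comparing with the mean of the
identity shows that `π₁` has multiplicity at most `|G|`
(`IsIrreducibleCovariantPair.card_le_of_orthogonal`). A maximal orthogonal family of isometric
intertwiners `S₁, …, S_r` from `π₁` to `ρ` then spans all of them, and `eᵢ ⊗ y ↦ Sᵢ y` identifies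
`ℂ ^ r ⊗ H₁` with the isotypic component of `π₁`.

Let `H` be the stabilizer of the class of `π₁`. For `h ∈ H` choose `V^h` implementing `α_h` on
`H₁`; Schur's lemma makes `V` projective. As `U_h Sⱼ (V^h)*` is again an intertwiner, it is a
combination of the `Sᵢ`, so that `U_h` acts on the isotypic component as `Λ_h ⊗ V^h`
(`exists_tensor_factor`). For `g ∉ H`, Schur's lemma shows that `U_g` moves the isotypic component
to an orthogonal subspace (`inner_translate_eq_zero`). Consequently the translates of the component
by coset representatives are orthogonal, they are permuted by `G`, and by irreducibility of `P` they
fill the space (`IsIrreducibleCovariantPair.exists_coset_decomposition`). The same orthogonality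
makes the action of `A ⋊ H` on the component irreducible
(`IsIrreducibleCovariantPair.isIrreducibleRep_subgroup`), which in turn forces `Λ` to be
irreducible (`isIrreducibleSet_of_tensor`).
-/

open scoped TensorProduct InnerProduct

/-! ### Intertwining operators and Schur's lemma -/

/-- The bounded operator `S` intertwines the representation `π` with the representation `ρ`. -/
def Intertwines {A E F : Type*} [CStarAlgebra A]
    [NormedAddCommGroup E] [InnerProductSpace ℂ E] [CompleteSpace E]
    [NormedAddCommGroup F] [InnerProductSpace ℂ F] [CompleteSpace F]
    (π : A →⋆ₐ[ℂ] (E →L[ℂ] E)) (ρ : A →⋆ₐ[ℂ] (F →L[ℂ] F)) (S : E →L[ℂ] F) : Prop :=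
  ∀ a x, S (π a x) = ρ a (S x)

section Intertwining

variable {A E F D : Type*} [CStarAlgebra A]
  [NormedAddCommGroup E] [InnerProductSpace ℂ E] [CompleteSpace E]
  [NormedAddCommGroup F] [InnerProductSpace ℂ F] [CompleteSpace F]
  [NormedAddCommGroup D] [InnerProductSpace ℂ D] [CompleteSpace D]
  {π : A →⋆ₐ[ℂ] (E →L[ℂ] E)} {ρ : A →⋆ₐ[ℂ] (F →L[ℂ] F)} {τ : A →⋆ₐ[ℂ] (D →L[ℂ] D)}

theorem StarAlgHom.inner_apply_left (π : A →⋆ₐ[ℂ] (E →L[ℂ] E)) (a : A) (x y : E) :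
    inner ℂ (π a x) y = inner ℂ x (π (star a) y) := by
  rw [map_star, ContinuousLinearMap.star_eq_adjoint, ContinuousLinearMap.adjoint_inner_right]

theorem Intertwines.comp {S : F →L[ℂ] D} {R : E →L[ℂ] F} (hS : Intertwines ρ τ S)
    (hR : Intertwines π ρ R) : Intertwines π τ (S ∘L R) := fun a x => by
  simp [hR a x, hS a (R x)]

theorem Intertwines.adjoint {S : E →L[ℂ] F} (hS : Intertwines π ρ S) :
    Intertwines ρ π (ContinuousLinearMap.adjoint S) := by
  intro a y
  refine ext_inner_right ℂ fun x => ?_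
  rw [ContinuousLinearMap.adjoint_inner_left, π.inner_apply_left, ρ.inner_apply_left,
    ContinuousLinearMap.adjoint_inner_left, hS]

theorem Intertwines.commute {T : E →L[ℂ] E} (hT : Intertwines π π T) (a : A) :
    Commute T (π a) := by
  ext x; exact hT a x

/-- No closedness is needed: the range of `π` is stable under adjoints. -/
theorem mem_orthogonal_of_invariant {K : Submodule ℂ E} (hK : ∀ a, ∀ x ∈ K, π a x ∈ K) (a : A)
    {x : E} (hx : x ∈ Kᗮ) : π a x ∈ Kᗮ := by
  rw [Submodule.mem_orthogonal'] at hx ⊢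
  intro y hy
  rw [π.inner_apply_left]
  exact hx _ (hK _ _ hy)

theorem intertwines_starProjection {K : Submodule ℂ E} [K.HasOrthogonalProjection]
    (hK : ∀ a, ∀ x ∈ K, π a x ∈ K) : Intertwines π π K.starProjection := by
  intro a x
  refine Submodule.eq_starProjection_of_mem_orthogonal (hK a _ (K.starProjection_apply_mem x)) ?_
  rw [← map_sub]
  exact mem_orthogonal_of_invariant hK a (K.sub_starProjection_mem_orthogonal x)

/-- A self-adjoint operator commuting with an irreducible set is a scalar: if its spectrum had two
points, bump functions `f`, `g` at these points would have `f(T) g(T) = 0`, and the kernel of `f(T)`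
would be a nontrivial closed invariant subspace. -/
theorem IsIrreducibleSet.exists_eq_algebraMap_of_isSelfAdjoint {S : Set (E →L[ℂ] E)}
    (hS : IsIrreducibleSet S) {T : E →L[ℂ] E} (hT : IsSelfAdjoint T)
    (hc : ∀ R ∈ S, Commute T R) : ∃ c : ℝ, T = algebraMap ℝ (E →L[ℂ] E) c := by
  have := hS.1
  obtain ⟨l, hl⟩ := ContinuousFunctionalCalculus.spectrum_nonempty (R := ℝ) T hT
  refine ⟨l, ?_⟩
  by_cases hsub : spectrum ℝ T ⊆ {l}
  · exact CFC.eq_algebraMap_of_spectrum_subset_singleton T l hsub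
  exfalso
  obtain ⟨m, hm, hml⟩ := Set.not_subset.1 hsub
  have hml : m ≠ l := hml
  set d : ℝ := |l - m| / 2 with hd
  have hd0 : 0 < d := by
    have : 0 < |l - m| := abs_pos.2 (sub_ne_zero.2 hml.symm)
    positivity
  have hne : ∀ p ∈ spectrum ℝ T, cfc (fun t : ℝ => max 0 (d - |t - p|)) T ≠ 0 := by
    intro p hp h0
    have hmem : d ∈ spectrum ℝ (cfc (fun t : ℝ => max 0 (d - |t - p|)) T) := by
      rw [cfc_map_spectrum (fun t : ℝ => max 0 (d - |t - p|)) T hT (by fun_prop)]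
      exact ⟨p, hp, by simp [hd0.le]⟩
    rw [h0, spectrum.zero_eq] at hmem
    exact hd0.ne' hmem
  have hprod : cfc (fun t : ℝ => max 0 (d - |t - l|)) T *
      cfc (fun t : ℝ => max 0 (d - |t - m|)) T = 0 := by
    rw [← cfc_mul _ _ T (by fun_prop) (by fun_prop)]
    refine (cfc_congr fun t _ => ?_).trans (cfc_zero ℝ T)
    by_contra hnz
    obtain ⟨h1, h2⟩ := mul_ne_zero_iff.1 hnz
    have h3 : |t - l| < d := by
      by_contra h; exact h1 (max_eq_left (by linarith))
    have h4 : |t - m| < d := by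
      by_contra h; exact h2 (max_eq_left (by linarith))
    have := abs_sub_le l t m
    rw [abs_sub_comm l t] at this
    linarith
  rcases hS.2 (cfc (fun t : ℝ => max 0 (d - |t - l|)) T).ker
    (ContinuousLinearMap.isClosed_ker _) (by
      intro R hR x hx
      have := (hc R hR).cfc_real (fun t : ℝ => max 0 (d - |t - l|))
      have h2 := congrArg (fun Q : E →L[ℂ] E => Q x) this.eq
      simp only [mul_apply_eq_comp] at h2
      have hx : cfc (fun t : ℝ => max 0 (d - |t - l|)) T x = 0 := hx
      change cfc (fun t : ℝ => max 0 (d - |t - l|)) T (R x) = 0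
      rw [h2, hx, map_zero]) with h | h
  · refine hne m hm ?_
    ext x
    have : cfc (fun t : ℝ => max 0 (d - |t - m|)) T x ∈
        (cfc (fun t : ℝ => max 0 (d - |t - l|)) T).ker := by
      change _ = _
      exact congrArg (fun Q : E →L[ℂ] E => Q x) hprod
    rw [h] at this
    exact this
  · refine hne l hl ?_
    ext x
    have : x ∈ (cfc (fun t : ℝ => max 0 (d - |t - l|)) T).ker := by rw [h]; trivial
    exact this

/-- **Schur's lemma**: an operator commuting with a self-adjoint irreducible set is a scalar. -/
theorem IsIrreducibleSet.exists_eq_smul_one {S : Set (E →L[ℂ] E)}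
    (hS : IsIrreducibleSet S) (hstar : ∀ R ∈ S, star R ∈ S) {T : E →L[ℂ] E}
    (hc : ∀ R ∈ S, Commute T R) : ∃ c : ℂ, T = c • 1 := by
  have hc' : ∀ R ∈ S, Commute (star T) R := fun R hR => by
    have := (hc _ (hstar R hR)).star_star
    rwa [star_star] at this
  obtain ⟨b, hb⟩ := hS.exists_eq_algebraMap_of_isSelfAdjoint (realPart T).2 (fun R hR => by
    rw [realPart_apply_coe]
    exact ((hc R hR).add_left (hc' R hR)).smul_left _)
  obtain ⟨c, hcc⟩ := hS.exists_eq_algebraMap_of_isSelfAdjoint (imaginaryPart T).2 (fun R hR => by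
    rw [imaginaryPart_apply_coe]
    exact ((((hc R hR).sub_left (hc' R hR)).smul_left _).smul_left _))
  refine ⟨b + Complex.I * c, ?_⟩
  rw [← realPart_add_I_smul_imaginaryPart T, hb, hcc]
  simp only [Algebra.algebraMap_eq_smul_one, add_smul, mul_smul]
  rfl

theorem IsIrreducibleRep.exists_eq_smul_one (hπ : IsIrreducibleRep π) {T : E →L[ℂ] E}
    (hT : Intertwines π π T) : ∃ c : ℂ, T = c • 1 := by
  refine IsIrreducibleSet.exists_eq_smul_one hπ ?_ ?_
  · rintro _ ⟨a, rfl⟩; exact ⟨star a, map_star π a⟩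
  · rintro _ ⟨a, rfl⟩; exact hT.commute a

/-- A nonzero intertwiner from an irreducible representation is a multiple of an isometry. -/
theorem IsIrreducibleRep.exists_isometry (hπ : IsIrreducibleRep π) {X : E →L[ℂ] F}
    (hX : Intertwines π ρ X) (h0 : X ≠ 0) :
    ∃ (t : ℂ) (S : E →ₗᵢ[ℂ] F), t ≠ 0 ∧ Intertwines π ρ S.toContinuousLinearMap ∧
      X = t • S.toContinuousLinearMap := by
  obtain ⟨c, hc⟩ := hπ.exists_eq_smul_one (hX.adjoint.comp hX)
  have hn : ∀ x, (‖X x‖ : ℂ) ^ 2 = c * (‖x‖ : ℂ) ^ 2 := by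
    intro x
    have h1 : ContinuousLinearMap.adjoint X (X x) = c • x := by
      simpa using congrArg (fun Q : E →L[ℂ] E => Q x) hc
    have h2 : inner ℂ x (ContinuousLinearMap.adjoint X (X x)) = inner ℂ x (c • x) := by rw [h1]
    rw [ContinuousLinearMap.adjoint_inner_right, inner_smul_right, inner_self_eq_norm_sq_to_K,
      inner_self_eq_norm_sq_to_K] at h2
    exact h2
  obtain ⟨x₀, hx₀⟩ : ∃ x, X x ≠ 0 := by
    by_contra! h; exact h0 (ContinuousLinearMap.ext h)
  have hx₀' : x₀ ≠ 0 := by rintro rfl; exact hx₀ (map_zero X)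
  set k : ℝ := ‖X x₀‖ / ‖x₀‖ with hk
  have hxn : ‖x₀‖ ≠ 0 := norm_ne_zero_iff.2 hx₀'
  have hk0 : 0 < k := div_pos (norm_pos_iff.2 hx₀) (norm_pos_iff.2 hx₀')
  have hck : c = (k : ℂ) ^ 2 := by
    have h2 : (‖x₀‖ : ℂ) ≠ 0 := by exact_mod_cast hxn
    rw [hk]; push_cast
    rw [div_pow, hn x₀, mul_div_cancel_right₀ _ (pow_ne_zero 2 h2)]
  have hkx : ∀ x, ‖X x‖ = k * ‖x‖ := by
    intro x
    have h2 := hn x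
    rw [hck, ← mul_pow] at h2
    have h3 : ‖X x‖ ^ 2 = (k * ‖x‖) ^ 2 := by exact_mod_cast h2
    exact (pow_left_inj₀ (norm_nonneg _) (by positivity) two_ne_zero).1 h3
  have hkC : (k : ℂ) ≠ 0 := by exact_mod_cast hk0.ne'
  refine ⟨k, ⟨((k : ℂ)⁻¹ • X : E →L[ℂ] F), fun x => ?_⟩, hkC, fun a x => ?_, ?_⟩
  · simp [norm_smul, hkx, abs_of_pos hk0, hk0.ne']
  · simp [hX a x]
  · ext x; exact (smul_inv_smul₀ hkC (X x)).symm

/-- The range of an isometric intertwiner is closed and invariant, so it is everything. -/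
theorem IsIrreducibleRep.unitarilyEquivalent (hπ : IsIrreducibleRep π) (hρ : IsIrreducibleRep ρ)
    {X : E →L[ℂ] F} (hX : Intertwines π ρ X) (h0 : X ≠ 0) : UnitarilyEquivalent π ρ := by
  obtain ⟨t, S, -, hS, -⟩ := hπ.exists_isometry hX h0
  have hcl : IsClosed (LinearMap.range S.toLinearMap : Set F) := by
    have := S.isometry.isClosedEmbedding.isClosed_range
    rwa [← LinearIsometry.coe_toLinearMap, ← LinearMap.coe_range] at this
  rcases hρ.2 _ hcl (by
    rintro _ ⟨a, rfl⟩ _ ⟨x, rfl⟩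
    exact ⟨π a x, hS a x⟩) with h | h
  · have := hπ.1
    obtain ⟨x, hx⟩ := exists_ne (0 : E)
    refine absurd ?_ hx
    have h2 : S x ∈ LinearMap.range S.toLinearMap := ⟨x, rfl⟩
    rw [h, Submodule.mem_bot] at h2
    exact S.injective (by rw [h2, map_zero])
  · refine ⟨LinearIsometryEquiv.ofSurjective S fun y => ?_, fun a x => hS a x⟩
    have : y ∈ LinearMap.range S.toLinearMap := by rw [h]; trivial
    exact this

/-- Compression of a representation to the range of an isometry, when this is invariant. -/
theorem exists_compression (ρ : A →⋆ₐ[ℂ] (F →L[ℂ] F)) (S : E →ₗᵢ[ℂ] F)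
    (h : ∀ a x, ∃ y, ρ a (S x) = S y) :
    ∃ π : A →⋆ₐ[ℂ] (E →L[ℂ] E), Intertwines π ρ S.toContinuousLinearMap := by
  set R : E →L[ℂ] F := S.toContinuousLinearMap with hR
  have hRS : ∀ x, R x = S x := fun _ => rfl
  have hSS : ∀ x, ContinuousLinearMap.adjoint R (R x) = x := fun x =>
    ext_inner_right ℂ fun y => by
      rw [ContinuousLinearMap.adjoint_inner_left, hRS, hRS, S.inner_map_map]
  have key : ∀ a x, R (ContinuousLinearMap.adjoint R (ρ a (R x))) = ρ a (R x) := by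
    intro a x
    obtain ⟨y, hy⟩ := h a x
    rw [hRS x, hy, ← hRS, hSS]
  let f : A → (E →L[ℂ] E) := fun a => ContinuousLinearMap.adjoint R ∘L ρ a ∘L R
  have hf : ∀ a x, f a x = ContinuousLinearMap.adjoint R (ρ a (R x)) := fun _ _ => rfl
  refine ⟨{ toFun := f
            map_one' := ?_, map_mul' := ?_, map_zero' := ?_, map_add' := ?_, commutes' := ?_
            map_star' := ?_ }, fun a x => key a x⟩
  · ext x; simp [hf, hSS]
  · intro a b; ext x; simp [hf, key]
  · ext x; simp [hf]
  · intro a b; ext x; simp [hf]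
  · intro c; ext x; simp [hf, hSS, Algebra.algebraMap_eq_smul_one]
  · intro a; ext x
    refine ext_inner_right ℂ fun y => ?_
    rw [ContinuousLinearMap.star_eq_adjoint, ContinuousLinearMap.adjoint_inner_left, hf, hf,
      ContinuousLinearMap.adjoint_inner_left, ContinuousLinearMap.adjoint_inner_right,
      ρ.inner_apply_left, star_star]

omit [CompleteSpace E] [CompleteSpace F] in
/-- Isometries with pairwise orthogonal ranges add up to an isometry of the direct sum. -/
theorem exists_sum_isometry {ι : Type*} [Fintype ι] (S : ι → E →ₗᵢ[ℂ] F)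
    (hS : ∀ i j, i ≠ j → ∀ x y, inner ℂ (S i x) (S j y) = 0) :
    ∃ T : PiLp 2 (fun _ : ι => E) →ₗᵢ[ℂ] F, ∀ y, T y = ∑ i, S i (y i) := by
  classical
  let L : PiLp 2 (fun _ : ι => E) →ₗ[ℂ] F :=
    { toFun := fun y => ∑ i, S i (y i)
      map_add' := fun x y => by simp [Finset.sum_add_distrib]
      map_smul' := fun c x => by simp [Finset.smul_sum] }
  refine ⟨L.isometryOfInner fun x y => ?_, fun _ => rfl⟩
  change inner ℂ (∑ i, S i (x i)) (∑ i, S i (y i)) = _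
  rw [sum_inner, PiLp.inner_apply]
  refine Finset.sum_congr rfl fun i _ => ?_
  rw [inner_sum, Finset.sum_eq_single i]
  · exact (S i).inner_map_map _ _
  · exact fun j _ hj => hS i j hj.symm _ _
  · simp

end Intertwining

/-! ### Averaging over the group, and finiteness of the multiplicities -/

/-- The pair `(ρ, u)` is covariant for the action `α`, and no nontrivial closed subspace is
invariant under both `ρ` and `u`: these are the pairs that come from the irreducible
representations of the crossed product. -/
structure IsIrreducibleCovariantPair {G A E : Type*} [Group G] [CStarAlgebra A]
    [NormedAddCommGroup E] [InnerProductSpace ℂ E] [CompleteSpace E]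
    (α : G →* (A ≃⋆ₐ[ℂ] A)) (ρ : A →⋆ₐ[ℂ] (E →L[ℂ] E)) (u : G →* (E ≃ₗᵢ[ℂ] E)) : Prop where
  covariant : ∀ g a x, u g (ρ a x) = ρ (α g a) (u g x)
  nontrivial : Nontrivial E
  eq_bot_or_eq_top : ∀ K : Submodule ℂ E, IsClosed (K : Set E) →
    (∀ a, ∀ x ∈ K, ρ a x ∈ K) → (∀ g, ∀ x ∈ K, u g x ∈ K) → K = ⊥ ∨ K = ⊤

section CovariantPair

variable {G A E F : Type*} [Group G] [CStarAlgebra A]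
  [NormedAddCommGroup E] [InnerProductSpace ℂ E] [CompleteSpace E]
  [NormedAddCommGroup F] [InnerProductSpace ℂ F] [CompleteSpace F]
  {α : G →* (A ≃⋆ₐ[ℂ] A)} {ρ : A →⋆ₐ[ℂ] (E →L[ℂ] E)} {u : G →* (E ≃ₗᵢ[ℂ] E)}
  {π : A →⋆ₐ[ℂ] (F →L[ℂ] F)}

theorem action_apply_inv_apply {A G : Type*} [Group G] [CStarAlgebra A]
    (α : G →* (A ≃⋆ₐ[ℂ] A)) (g : G) (a : A) : α g (α g⁻¹ a) = a := by
  rw [CrossedProduct.map_mul_apply, mul_inv_cancel, map_one]; rfl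

theorem action_inv_apply_apply {A G : Type*} [Group G] [CStarAlgebra A]
    (α : G →* (A ≃⋆ₐ[ℂ] A)) (g : G) (a : A) : α g⁻¹ (α g a) = a := by
  rw [CrossedProduct.map_mul_apply, inv_mul_cancel, map_one]; rfl

omit [CompleteSpace E] in
theorem map_mul_isometry_apply (u : G →* (E ≃ₗᵢ[ℂ] E)) (g h : G) (x : E) :
    u (g * h) x = u g (u h x) := by
  rw [map_mul]; rfl

omit [CompleteSpace E] in
theorem map_one_isometry_apply (u : G →* (E ≃ₗᵢ[ℂ] E)) (x : E) : u 1 x = x := by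
  rw [map_one]; rfl

omit [CompleteSpace E] in
theorem inner_isometry_apply_left (u : G →* (E ≃ₗᵢ[ℂ] E)) (g : G) (x y : E) :
    inner ℂ (u g x) y = inner ℂ x (u g⁻¹ y) := by
  rw [← (u g).inner_map_map x (u g⁻¹ y), ← map_mul_isometry_apply, mul_inv_cancel,
    map_one_isometry_apply]

namespace IsIrreducibleCovariantPair

/-- The mean over `G` of an operator commuting with `ρ` commutes with `ρ` and `u`, so it is a
scalar. -/
theorem exists_sum_conj_eq_smul [Fintype G] (h : IsIrreducibleCovariantPair α ρ u)
    {T : E →L[ℂ] E} (hT : Intertwines ρ ρ T) :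
    ∃ c : ℂ, ∀ x, ∑ g, u g (T (u g⁻¹ x)) = c • x := by
  let U : G → (E →L[ℂ] E) := fun g => ((u g).toContinuousLinearEquiv : E →L[ℂ] E)
  have hU : ∀ g x, U g x = u g x := fun _ _ => rfl
  let B : E →L[ℂ] E := ∑ g, U g ∘L T ∘L U g⁻¹
  have hB : ∀ x, B x = ∑ g, u g (T (u g⁻¹ x)) := fun x => by
    simp only [B, sum_apply]; rfl
  obtain ⟨c, hc⟩ := IsIrreducibleSet.exists_eq_smul_one (S := Set.range ρ ∪ Set.range U) (T := B)
    ⟨h.nontrivial, fun K hK hinv => h.eq_bot_or_eq_top K hK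
      (fun a => hinv _ (Or.inl ⟨a, rfl⟩)) (fun g => hinv _ (Or.inr ⟨g, rfl⟩))⟩
    (by
      rintro _ (⟨a, rfl⟩ | ⟨g, rfl⟩)
      · exact Or.inl ⟨star a, map_star ρ a⟩
      · refine Or.inr ⟨g⁻¹, ?_⟩
        ext x
        refine ext_inner_right ℂ fun y => ?_
        rw [ContinuousLinearMap.star_eq_adjoint, ContinuousLinearMap.adjoint_inner_left, hU, hU,
          inner_isometry_apply_left, inv_inv])
    (by
      rintro _ (⟨a, rfl⟩ | ⟨k, rfl⟩)
      · ext x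
        rw [mul_apply_eq_comp, mul_apply_eq_comp, hB, hB, map_sum]
        refine Finset.sum_congr rfl fun g _ => ?_
        rw [h.covariant, hT, h.covariant, action_apply_inv_apply]
      · ext x
        rw [mul_apply_eq_comp, mul_apply_eq_comp, hB, hB, hU, hU, map_sum]
        rw [← Equiv.sum_comp (Equiv.mulLeft k)]
        refine Finset.sum_congr rfl fun g _ => ?_
        rw [Equiv.coe_mulLeft, map_mul_isometry_apply, ← map_mul_isometry_apply u _ k]
        simp)
  exact ⟨c, fun x => by rw [← hB, hc]; rfl⟩

/-- The quadratic form attached to the mean of `S S*`. -/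
theorem exists_sum_norm_sq_eq [Fintype G] (h : IsIrreducibleCovariantPair α ρ u)
    {S : F →L[ℂ] E} (hS : Intertwines ρ ρ (S ∘L ContinuousLinearMap.adjoint S)) :
    ∃ c : ℝ, ∀ x, ∑ g, ‖ContinuousLinearMap.adjoint S (u g⁻¹ x)‖ ^ 2 = c * ‖x‖ ^ 2 := by
  obtain ⟨c, hc⟩ := h.exists_sum_conj_eq_smul hS
  refine ⟨c.re, fun x => ?_⟩
  have h1 : inner ℂ (∑ g, u g ((S ∘L ContinuousLinearMap.adjoint S) (u g⁻¹ x))) x =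
      inner ℂ (c • x) x := by rw [hc]
  rw [sum_inner, inner_smul_left, inner_self_eq_norm_sq_to_K] at h1
  have h2 : ∀ g, inner ℂ (u g ((S ∘L ContinuousLinearMap.adjoint S) (u g⁻¹ x))) x =
      ((‖ContinuousLinearMap.adjoint S (u g⁻¹ x)‖ ^ 2 : ℝ) : ℂ) := by
    intro g
    rw [inner_isometry_apply_left, ContinuousLinearMap.comp_apply,
      ← ContinuousLinearMap.adjoint_inner_right, inner_self_eq_norm_sq_to_K]
    norm_cast
  simp only [h2] at h1
  have h3 := congrArg Complex.re h1
  rw [← Complex.ofReal_sum, Complex.ofReal_re] at h3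
  rw [h3]
  have : ((‖x‖ : ℂ)) ^ 2 = ((‖x‖ ^ 2 : ℝ) : ℂ) := by norm_cast
  change ((starRingEnd ℂ) c * (‖x‖ : ℂ) ^ 2).re = _
  rw [this, Complex.re_mul_ofReal, Complex.conj_re]

/-- There is an irreducible subrepresentation of `ρ`: the scalar that is the mean of the projection
onto a closed invariant subspace drops by at least `1` when the subspace shrinks, so there are
minimal ones. -/
theorem exists_minimal_subspace [Finite G] (h : IsIrreducibleCovariantPair α ρ u) :
    ∃ M : Submodule ℂ E, IsClosed (M : Set E) ∧ (∀ a, ∀ x ∈ M, ρ a x ∈ M) ∧ M ≠ ⊥ ∧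
      ∀ K : Submodule ℂ E, IsClosed (K : Set E) → (∀ a, ∀ x ∈ K, ρ a x ∈ K) → K ≤ M →
        K = ⊥ ∨ K = M := by
  have := Fintype.ofFinite G
  have := h.nontrivial
  let P : Submodule ℂ E → Prop := fun K =>
    IsClosed (K : Set E) ∧ (∀ a, ∀ x ∈ K, ρ a x ∈ K) ∧ K ≠ ⊥
  have hproj : ∀ K : Submodule ℂ E, IsClosed (K : Set E) → K.HasOrthogonalProjection := by
    intro K hK
    have := hK.completeSpace_coe
    infer_instance
  have hc : ∀ K : {K // P K}, ∃ c : ℝ, ∀ [K.1.HasOrthogonalProjection], ∀ x : E,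
      ∑ g, ‖K.1.starProjection (u g⁻¹ x)‖ ^ 2 = c * ‖x‖ ^ 2 := by
    rintro ⟨K, hK, hinv, -⟩
    have := hproj K hK
    have hs := intertwines_starProjection hinv
    obtain ⟨c, hc⟩ := h.exists_sum_norm_sq_eq (S := K.starProjection) (hs.comp hs.adjoint)
    refine ⟨c, fun x => ?_⟩
    rw [← hc]
    rw [← ContinuousLinearMap.star_eq_adjoint,
      (isSelfAdjoint_starProjection K).star_eq]
  choose c hc using hc
  -- the mean grows by at least `1` on a vector of `L` orthogonal to `K`
  have hstep : ∀ K L : {K // P K}, K.1 < L.1 → c K + 1 ≤ c L := by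
    rintro ⟨K, hK, hKi, hK0⟩ ⟨L, hL, hLi, hL0⟩ (hKL : K < L)
    have := hproj K hK
    have := hproj L hL
    classical
    have hne : Kᗮ ⊓ L ≠ ⊥ := by
      intro h0
      have := Submodule.sup_orthogonal_inf_of_hasOrthogonalProjection hKL.le
      rw [h0, sup_bot_eq] at this
      exact hKL.ne this
    obtain ⟨x, ⟨hxK, hxL⟩, hx0⟩ := (Submodule.ne_bot_iff _).1 hne
    have h1 := hc ⟨K, hK, hKi, hK0⟩ x
    have h2 := hc ⟨L, hL, hLi, hL0⟩ x
    have hle : ∑ g, ‖K.starProjection (u g⁻¹ x)‖ ^ 2 + ‖x‖ ^ 2 ≤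
        ∑ g, ‖L.starProjection (u g⁻¹ x)‖ ^ 2 := by
      have hmono : ∀ g, ‖K.starProjection (u g⁻¹ x)‖ ^ 2 + (if g = 1 then ‖x‖ ^ 2 else 0) ≤
          ‖L.starProjection (u g⁻¹ x)‖ ^ 2 := by
        intro g
        split_ifs with hg
        · subst hg
          rw [inv_one, map_one_isometry_apply, K.starProjection_apply_eq_zero_iff.2 hxK,
            L.starProjection_eq_self_iff.2 hxL]
          simp
        · rw [add_zero]
          refine pow_le_pow_left₀ (norm_nonneg _) ?_ 2
          rw [← congrArg (fun Q : E →L[ℂ] E => Q (u g⁻¹ x))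
            (Submodule.starProjection_comp_starProjection_of_le hKL.le)]
          exact K.norm_starProjection_apply_le _
      have := Finset.sum_le_sum fun g (_ : g ∈ Finset.univ) => hmono g
      rw [Finset.sum_add_distrib] at this
      simpa using this
    rw [h1, h2, ← add_one_mul] at hle
    exact le_of_mul_le_mul_right hle (by positivity)
  have hcnn : ∀ K, 0 ≤ c K := by
    rintro ⟨K, hK, hKi, hK0⟩
    have := hproj K hK
    obtain ⟨x, hx⟩ := exists_ne (0 : E)
    have h1 := hc ⟨K, hK, hKi, hK0⟩ x
    have : 0 ≤ c ⟨K, hK, hKi, hK0⟩ * ‖x‖ ^ 2 := by rw [← h1]; positivity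
    exact nonneg_of_mul_nonneg_left this (by positivity)
  have hne : Nonempty {K // P K} :=
    ⟨⟨⊤, isClosed_univ, fun _ _ _ => trivial, top_ne_bot⟩⟩
  obtain ⟨M, hM⟩ := (measure fun K : {K // P K} => ⌊c K⌋₊).wf.has_min Set.univ Set.univ_nonempty
  refine ⟨M.1, M.2.1, M.2.2.1, M.2.2.2, fun K hK hKi hKM => ?_⟩
  by_contra! hcon
  have h1 := hstep ⟨K, hK, hKi, hcon.1⟩ M (lt_of_le_of_ne hKM hcon.2)
  refine hM.2 ⟨K, hK, hKi, hcon.1⟩ trivial ?_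
  change ⌊_⌋₊ < ⌊_⌋₊
  rw [Nat.lt_iff_add_one_le, ← Nat.floor_add_one (hcnn _)]
  exact Nat.floor_le_floor h1

/-- The multiplicity of an irreducible representation in `ρ` is at most the order of `G`: each
copy contributes at least `1` to the mean of a projection, and this mean is at most `|G|`. -/
theorem card_le_of_orthogonal [Fintype G] (h : IsIrreducibleCovariantPair α ρ u) [Nontrivial F]
    {r : ℕ} {S : Fin r → F →ₗᵢ[ℂ] E} (hS : ∀ i, Intertwines π ρ (S i).toContinuousLinearMap)
    (hort : ∀ i j, i ≠ j → ∀ x y, inner ℂ (S i x) (S j y) = 0) : r ≤ Fintype.card G := by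
  have := h.nontrivial
  choose c hc using fun i => h.exists_sum_norm_sq_eq ((hS i).comp (hS i).adjoint)
  have hc1 : ∀ i, 1 ≤ c i := by
    intro i
    obtain ⟨y, hy⟩ := exists_ne (0 : F)
    have h1 := hc i (S i y)
    have h2 : ContinuousLinearMap.adjoint (S i).toContinuousLinearMap (S i y) = y :=
      ext_inner_right ℂ fun z => by
        rw [ContinuousLinearMap.adjoint_inner_left]
        exact (S i).inner_map_map _ _
    have h3 := Finset.single_le_sum (f := fun g => ‖ContinuousLinearMap.adjoint
      (S i).toContinuousLinearMap (u g⁻¹ (S i y))‖ ^ 2) (fun _ _ => by positivity)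
      (Finset.mem_univ 1)
    rw [h1, inv_one, map_one_isometry_apply, h2, (S i).norm_map] at h3
    exact le_of_mul_le_mul_right (by rwa [one_mul]) (by positivity : 0 < ‖y‖ ^ 2)
  obtain ⟨T, hT⟩ := exists_sum_isometry S hort
  have hbessel : ∀ x, ∑ i, ‖ContinuousLinearMap.adjoint (S i).toContinuousLinearMap x‖ ^ 2 ≤
      ‖x‖ ^ 2 := by
    intro x
    have hi : ∀ i, ContinuousLinearMap.adjoint (S i).toContinuousLinearMap x =
        (ContinuousLinearMap.adjoint T.toContinuousLinearMap x) i := by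
      intro i
      refine ext_inner_left ℂ fun y => ?_
      have h1 : inner ℂ (PiLp.single 2 i y)
          (ContinuousLinearMap.adjoint T.toContinuousLinearMap x) = inner ℂ (S i y) x := by
        rw [ContinuousLinearMap.adjoint_inner_right]
        change inner ℂ (T _) x = _
        rw [hT, Finset.sum_eq_single i]
        · simp
        · intro j _ hj; simp [hj]
        · simp
      rw [ContinuousLinearMap.adjoint_inner_right]
      refine h1.symm.trans ?_
      rw [PiLp.inner_apply, Finset.sum_eq_single i]
      · simp
      · intro j _ hj; simp [hj]
      · simp
    simp only [hi]
    rw [← PiLp.norm_sq_eq_of_L2]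
    refine pow_le_pow_left₀ (norm_nonneg _) ?_ 2
    refine (ContinuousLinearMap.le_opNorm _ _).trans ?_
    rw [LinearIsometryEquiv.norm_map]
    exact mul_le_of_le_one_left (norm_nonneg _) T.norm_toContinuousLinearMap_le
  obtain ⟨x, hx⟩ := exists_ne (0 : E)
  have h1 : (r : ℝ) * ‖x‖ ^ 2 ≤ (Fintype.card G : ℝ) * ‖x‖ ^ 2 := by
    calc (r : ℝ) * ‖x‖ ^ 2 = ∑ i : Fin r, 1 * ‖x‖ ^ 2 := by simp
      _ ≤ ∑ i, c i * ‖x‖ ^ 2 := Finset.sum_le_sum fun i _ => by gcongr; exact hc1 i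
      _ = ∑ g, ∑ i, ‖ContinuousLinearMap.adjoint (S i).toContinuousLinearMap
            (u g⁻¹ x)‖ ^ 2 := by
          rw [Finset.sum_comm]
          exact Finset.sum_congr rfl fun i _ => (hc i x).symm
      _ ≤ ∑ g : G, ‖x‖ ^ 2 := Finset.sum_le_sum fun g _ => (hbessel _).trans_eq (by simp)
      _ = _ := by simp
  exact_mod_cast le_of_mul_le_mul_right h1 (by positivity)

/-- A maximal family of orthogonal copies of an irreducible subrepresentation spans all the
intertwiners. -/
theorem exists_orthogonal_basis_intertwiners [Finite G] (h : IsIrreducibleCovariantPair α ρ u)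
    (hπ : IsIrreducibleRep π) {S₀ : F →ₗᵢ[ℂ] E}
    (hS₀ : Intertwines π ρ S₀.toContinuousLinearMap) :
    ∃ (r : ℕ) (S : Fin r → F →ₗᵢ[ℂ] E), 0 < r ∧
      (∀ i, Intertwines π ρ (S i).toContinuousLinearMap) ∧
      (∀ i j, i ≠ j → ∀ x y, inner ℂ (S i x) (S j y) = 0) ∧
      ∀ X : F →L[ℂ] E, Intertwines π ρ X →
        ∃ c : Fin r → ℂ, ∀ y, X y = ∑ i, c i • S i y := by
  have := Fintype.ofFinite G
  have := hπ.1
  let N : Set ℕ := {r | ∃ S : Fin r → F →ₗᵢ[ℂ] E,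
    (∀ i, Intertwines π ρ (S i).toContinuousLinearMap) ∧
      ∀ i j, i ≠ j → ∀ x y, inner ℂ (S i x) (S j y) = 0}
  have hbdd : BddAbove N := ⟨Fintype.card G, by
    rintro r ⟨S, hS, hort⟩
    exact h.card_le_of_orthogonal hS hort⟩
  have h1 : 1 ∈ N := ⟨fun _ => S₀, fun _ => hS₀, fun i j hij => absurd (Subsingleton.elim i j) hij⟩
  obtain ⟨S, hS, hort⟩ := Nat.sSup_mem ⟨1, h1⟩ hbdd
  have hmax : ∀ n ∈ N, n ≤ sSup N := fun n hn => le_csSup hbdd hn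
  refine ⟨sSup N, S, hmax 1 h1, hS, hort, fun X hX => ?_⟩
  choose c hc using fun i => hπ.exists_eq_smul_one ((hS i).adjoint.comp hX)
  have hcX : ∀ i x y, inner ℂ (S i x) (X y) = inner ℂ x (c i • y) := by
    intro i x y
    have h2 := congrArg (fun Q : F →L[ℂ] F => inner ℂ x (Q y)) (hc i)
    simp only [ContinuousLinearMap.comp_apply, ContinuousLinearMap.adjoint_inner_right] at h2
    exact h2
  refine ⟨c, ?_⟩
  -- `Y` is the component of `X` orthogonal to the family; maximality forces it to vanish
  let Y : F →L[ℂ] E := X - ∑ i, c i • (S i).toContinuousLinearMap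
  have hY : ∀ y, Y y = X y - ∑ i, c i • S i y := fun y => by simp [Y]
  have hYi : Intertwines π ρ Y := by
    intro a y
    rw [hY, hY, hX, map_sub, map_sum]
    congr 1
    refine Finset.sum_congr rfl fun i _ => ?_
    rw [map_smul]
    congr 1
    exact hS i a y
  have hYo : ∀ i x y, inner ℂ (S i x) (Y y) = 0 := by
    intro i x y
    rw [hY, inner_sub_right, hcX, inner_sum, Finset.sum_eq_single i]
    · rw [inner_smul_right, inner_smul_right, (S i).inner_map_map, sub_self]
    · intro j _ hj
      rw [inner_smul_right, hort i j hj.symm, mul_zero]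
    · simp
  by_cases hY0 : Y = 0
  · intro y
    have := hY y
    rw [hY0] at this
    exact (sub_eq_zero.1 this.symm)
  exfalso
  obtain ⟨t, R, ht, hR, hYR⟩ := hπ.exists_isometry hYi hY0
  have hRo : ∀ i x y, inner ℂ (S i x) (R y) = 0 := by
    intro i x y
    have h2 := hYo i x y
    rw [hYR] at h2
    change inner ℂ (S i x) (t • R y) = 0 at h2
    rw [inner_smul_right] at h2
    exact (mul_eq_zero.1 h2).resolve_left ht
  have hmem : sSup N + 1 ∈ N := by
    refine ⟨Fin.cons R S, fun i => ?_, fun i j => ?_⟩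
    · refine Fin.cases ?_ (fun i => ?_) i
      · exact hR
      · exact hS i
    · refine Fin.cases ?_ (fun i => ?_) i
      · refine Fin.cases ?_ (fun j => ?_) j
        · exact fun h => absurd rfl h
        · intro _ x y
          exact inner_eq_zero_symm.1 (hRo j y x)
      · refine Fin.cases ?_ (fun j => ?_) j
        · intro _ x y
          exact hRo i x y
        · intro hij
          exact hort i j fun h => hij (congrArg Fin.succ h)
  exact absurd (hmax _ hmem) (by omega)

end IsIrreducibleCovariantPair
end CovariantPair

/-! ### Covariant pairs and representations of crossed products -/

theorem Submodule.mem_orthogonal_span_iff {E : Type*} [NormedAddCommGroup E]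
    [InnerProductSpace ℂ E] {X : Set E} {y : E} :
    y ∈ (Submodule.span ℂ X)ᗮ ↔ ∀ x ∈ X, inner ℂ x y = 0 := by
  rw [Submodule.mem_orthogonal]
  refine ⟨fun h x hx => h x (Submodule.subset_span hx), fun h x hx => ?_⟩
  induction hx using Submodule.span_induction with
  | mem x hx => exact h x hx
  | zero => exact inner_zero_left _
  | add x z _ _ hx hz => rw [inner_add_left, hx, hz, add_zero]
  | smul c x _ hx => rw [inner_smul_left, hx, mul_zero]

theorem IsIrreducibleCovariantPair.eq_zero_of_orthogonal {G A E : Type*} [Group G]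
    [CStarAlgebra A] [NormedAddCommGroup E] [InnerProductSpace ℂ E] [CompleteSpace E]
    {α : G →* (A ≃⋆ₐ[ℂ] A)} {ρ : A →⋆ₐ[ℂ] (E →L[ℂ] E)} {u : G →* (E ≃ₗᵢ[ℂ] E)}
    (h : IsIrreducibleCovariantPair α ρ u) {X : Set E} (hρ : ∀ a, ∀ x ∈ X, ρ a x ∈ X)
    (hu : ∀ g, ∀ x ∈ X, u g x ∈ X) {x₀ : E} (hx₀ : x₀ ∈ X) (h0 : x₀ ≠ 0) {y : E}
    (hy : ∀ x ∈ X, inner ℂ x y = 0) : y = 0 := by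
  have hy' : y ∈ (Submodule.span ℂ X)ᗮ := Submodule.mem_orthogonal_span_iff.2 hy
  rcases h.eq_bot_or_eq_top (Submodule.span ℂ X)ᗮ (Submodule.isClosed_orthogonal _)
    (fun a z hz => Submodule.mem_orthogonal_span_iff.2 fun x hx => by
      have := Submodule.mem_orthogonal_span_iff.1 hz _ (hρ (star a) x hx)
      rwa [ρ.inner_apply_left, star_star] at this)
    (fun g z hz => Submodule.mem_orthogonal_span_iff.2 fun x hx => by
      have := Submodule.mem_orthogonal_span_iff.1 hz _ (hu g⁻¹ x hx)
      rwa [inner_isometry_apply_left, inv_inv] at this) with hK | hK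
  · rw [hK] at hy'
    exact hy'
  · have : x₀ ∈ (Submodule.span ℂ X)ᗮ := by rw [hK]; trivial
    exact absurd (inner_self_eq_zero.1 (Submodule.mem_orthogonal_span_iff.1 this x₀ hx₀)) h0

section CrossedProductReps

variable {G A E F : Type*} [Group G] [Finite G] [CStarAlgebra A]
  [NormedAddCommGroup E] [InnerProductSpace ℂ E] [CompleteSpace E]
  [NormedAddCommGroup F] [InnerProductSpace ℂ F] [CompleteSpace F]
  {α : G →* (A ≃⋆ₐ[ℂ] A)}

/-- A subspace invariant under the generators is invariant under the crossed product. -/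
theorem CrossedProduct.apply_mem_of_generators (P : CrossedProduct α →⋆ₐ[ℂ] (E →L[ℂ] E))
    {K : Submodule ℂ E} (hι : ∀ a, ∀ x ∈ K, P (CrossedProduct.ι α a) x ∈ K)
    (hU : ∀ g, ∀ x ∈ K, P (CrossedProduct.U α g : CrossedProduct α) x ∈ K)
    (b : CrossedProduct α) {x : E} (hx : x ∈ K) : P b x ∈ K := by
  have := Fintype.ofFinite G
  rw [CrossedProduct.eq_sum_coeff α b, map_sum, sum_apply]
  refine K.sum_mem fun g _ => ?_
  rw [map_mul, mul_apply_eq_comp]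
  exact hι _ _ (hU g x hx)

/-- The unitary representation of `G` contained in a representation of `A ⋊_α G`. -/
noncomputable def CrossedProduct.unitaryPart (P : CrossedProduct α →⋆ₐ[ℂ] (E →L[ℂ] E)) :
    G →* (E ≃ₗᵢ[ℂ] E) where
  toFun g := Unitary.linearIsometryEquiv
    ⟨P (CrossedProduct.U α g : CrossedProduct α), Unitary.map_mem P (CrossedProduct.U α g).2⟩
  map_one' := by ext x; simp [Unitary.linearIsometryEquiv]
  map_mul' g h := by ext x; simp [Unitary.linearIsometryEquiv]

theorem CrossedProduct.unitaryPart_apply (P : CrossedProduct α →⋆ₐ[ℂ] (E →L[ℂ] E)) (g : G)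
    (x : E) :
    CrossedProduct.unitaryPart P g x = P (CrossedProduct.U α g : CrossedProduct α) x := rfl

theorem CrossedProduct.isIrreducibleCovariantPair {P : CrossedProduct α →⋆ₐ[ℂ] (E →L[ℂ] E)}
    (hP : IsIrreducibleRep P) :
    IsIrreducibleCovariantPair α (P.comp (CrossedProduct.ι α)) (CrossedProduct.unitaryPart P) where
  covariant g a x := by
    rw [CrossedProduct.unitaryPart_apply, CrossedProduct.unitaryPart_apply,
      StarAlgHom.comp_apply, StarAlgHom.comp_apply, ← mul_apply_eq_comp, ← mul_apply_eq_comp,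
      ← map_mul, ← map_mul, ← CrossedProduct.covariant, mul_assoc,
      Unitary.star_mul_self_of_mem (CrossedProduct.U α g).2, mul_one]
  nontrivial := hP.1
  eq_bot_or_eq_top K hK hι hU := hP.2 K hK (by
    rintro _ ⟨b, rfl⟩ x hx
    exact CrossedProduct.apply_mem_of_generators P hι hU b hx)

/-- Every covariant pair comes from a representation of the crossed product. -/
theorem CrossedProduct.exists_of_covariant {ρ : A →⋆ₐ[ℂ] (E →L[ℂ] E)} {u : G →* (E ≃ₗᵢ[ℂ] E)}
    (hcov : ∀ g a x, u g (ρ a x) = ρ (α g a) (u g x)) :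
    ∃ P : CrossedProduct α →⋆ₐ[ℂ] (E →L[ℂ] E), (∀ a, P (CrossedProduct.ι α a) = ρ a) ∧
      ∀ g x, P (CrossedProduct.U α g : CrossedProduct α) x = u g x := by
  obtain ⟨P, ⟨hι, hU⟩, -⟩ := CrossedProduct.existsUnique_lift α ρ
    ((Unitary.linearIsometryEquiv (𝕜 := ℂ) (H := E)).symm.toMonoidHom.comp u) (fun g a => by
      have h1 : ((Unitary.linearIsometryEquiv.symm (u g) : unitary (E →L[ℂ] E)) : E →L[ℂ] E) * ρ a
          = ρ (α g a) * (Unitary.linearIsometryEquiv.symm (u g) : unitary (E →L[ℂ] E)) := by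
        ext x
        exact hcov g a x
      change ((Unitary.linearIsometryEquiv.symm (u g) : unitary (E →L[ℂ] E)) : E →L[ℂ] E) * ρ a
        * star ((Unitary.linearIsometryEquiv.symm (u g) : unitary (E →L[ℂ] E)) : E →L[ℂ] E) = _
      rw [h1, mul_assoc, Unitary.mul_star_self_of_mem (Subtype.prop _), mul_one])
  exact ⟨P, hι, fun g x => by rw [hU]; rfl⟩

end CrossedProductReps

/-! ### The stabilizer of an irreducible representation, and projective representations -/

section Stabilizer

variable {G A F : Type*} [Group G] [CStarAlgebra A]
  [NormedAddCommGroup F] [InnerProductSpace ℂ F] [CompleteSpace F]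

theorem twist_apply (π : A →⋆ₐ[ℂ] (F →L[ℂ] F)) (α : G →* (A ≃⋆ₐ[ℂ] A)) (g : G) (a : A) :
    twist π α g a = π (α g a) := rfl

theorem IsIrreducibleRep.twist {π : A →⋆ₐ[ℂ] (F →L[ℂ] F)} (hπ : IsIrreducibleRep π)
    (α : G →* (A ≃⋆ₐ[ℂ] A)) (g : G) : IsIrreducibleRep (twist π α g) := by
  refine ⟨hπ.1, fun K hK hinv => hπ.2 K hK ?_⟩
  rintro _ ⟨a, rfl⟩ x hx
  have := hinv _ ⟨α g⁻¹ a, rfl⟩ x hx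
  rwa [twist_apply, action_apply_inv_apply] at this

/-- The stabilizer of the unitary equivalence class of `π`. -/
def repStabilizer (π : A →⋆ₐ[ℂ] (F →L[ℂ] F)) (α : G →* (A ≃⋆ₐ[ℂ] A)) : Subgroup G where
  carrier := {g | UnitarilyEquivalent (twist π α g) π}
  one_mem' := ⟨LinearIsometryEquiv.refl ℂ F, fun a x => by simp [twist_apply]⟩
  mul_mem' := by
    rintro g h ⟨V, hV⟩ ⟨W, hW⟩
    refine ⟨V.trans W, fun a x => ?_⟩
    rw [twist_apply, ← CrossedProduct.map_mul_apply, LinearIsometryEquiv.trans_apply,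
      LinearIsometryEquiv.trans_apply, ← twist_apply, hV, ← twist_apply, hW]
  inv_mem' := by
    rintro g ⟨W, hW⟩
    refine ⟨W.symm, fun a x => ?_⟩
    have h1 := hW (α g⁻¹ a) (W.symm x)
    rw [twist_apply, action_apply_inv_apply, W.apply_symm_apply] at h1
    rw [LinearIsometryEquiv.symm_apply_eq, h1, twist_apply]

theorem mem_repStabilizer {π : A →⋆ₐ[ℂ] (F →L[ℂ] F)} {α : G →* (A ≃⋆ₐ[ℂ] A)} {g : G} :
    g ∈ repStabilizer π α ↔ UnitarilyEquivalent (twist π α g) π := Iff.rfl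

/-- Nonzero intertwiners between twists of `π` occur only within a coset of the stabilizer. -/
theorem mul_inv_mem_repStabilizer {π : A →⋆ₐ[ℂ] (F →L[ℂ] F)} (hπ : IsIrreducibleRep π)
    {α : G →* (A ≃⋆ₐ[ℂ] A)} {g k : G} {X : F →L[ℂ] F}
    (hX : Intertwines (twist π α g) (twist π α k) X) (h0 : X ≠ 0) :
    g * k⁻¹ ∈ repStabilizer π α := by
  obtain ⟨W, hW⟩ := (hπ.twist α g).unitarilyEquivalent (hπ.twist α k) hX h0
  refine ⟨W, fun a x => ?_⟩
  rw [twist_apply, ← CrossedProduct.map_mul_apply, ← twist_apply, hW, twist_apply,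
    action_apply_inv_apply]

/-- Unitaries that are multiplicative up to scalars form a projective representation: the cocycle
identity comes from associativity. -/
theorem isUnitaryProjectiveRep_of_exists_smul {K : Type*} [Group K] [Nontrivial F]
    {V : K → unitary (F →L[ℂ] F)}
    (h : ∀ g k, ∃ c : ℂ, (V (g * k) : F →L[ℂ] F) = c • ((V g : F →L[ℂ] F) * (V k : F →L[ℂ] F))) :
    IsUnitaryProjectiveRep V := by
  choose c hc using h
  obtain ⟨x, hx⟩ := exists_ne (0 : F)
  have hcx : ∀ g k x, (V (g * k) : F →L[ℂ] F) x =
      c g k • (V g : F →L[ℂ] F) ((V k : F →L[ℂ] F) x) := fun g k x => by rw [hc]; rfl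
  have hnorm : ∀ g k, ‖c g k‖ = 1 := by
    intro g k
    have h1 := congrArg norm (hcx g k x)
    rw [norm_smul, Unitary.norm_map, Unitary.norm_map, Unitary.norm_map] at h1
    exact (mul_eq_right₀ (norm_ne_zero_iff.2 hx)).1 h1.symm
  refine ⟨fun g k => ⟨c g k, by rw [Submonoid.unitSphere]; simpa using hnorm g k⟩,
    fun g k l => ?_, hc⟩
  ext
  change c g k * c (g * k) l = c k l * c g (k * l)
  have h1 := hcx (g * k) l x
  rw [mul_assoc, hcx g (k * l), hcx k l, hcx g k, map_smul, smul_smul, smul_smul] at h1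
  have h3 : (V g : F →L[ℂ] F) ((V k : F →L[ℂ] F) ((V l : F →L[ℂ] F) x)) ≠ 0 := by
    rw [← norm_ne_zero_iff, Unitary.norm_map, Unitary.norm_map, Unitary.norm_map]
    exact norm_ne_zero_iff.2 hx
  have h4 : c g (k * l) * c k l = c (g * k) l * c g k := smul_left_injective ℂ h3 h1
  rw [mul_comm, ← h4, mul_comm]

/-- Unitaries implementing the action on an irreducible representation are multiplicative up to
scalars. -/
theorem exists_smul_of_implementing {π : A →⋆ₐ[ℂ] (F →L[ℂ] F)} (hπ : IsIrreducibleRep π)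
    {K : Type*} [Group K] {β : K →* (A ≃⋆ₐ[ℂ] A)} {V : K → (F ≃ₗᵢ[ℂ] F)}
    (hV : ∀ k a x, V k (π a x) = π (β k a) (V k x)) (g k : K) :
    ∃ c : ℂ, ∀ x, V (g * k) x = c • V g (V k x) := by
  have hVs : ∀ k a x, (V k).symm (π (β k a) x) = π a ((V k).symm x) := fun k a x => by
    rw [LinearIsometryEquiv.symm_apply_eq, hV, LinearIsometryEquiv.apply_symm_apply]
  -- `V_{gk} V_k* V_g*` commutes with `π`
  let Y : F ≃ₗᵢ[ℂ] F := ((V g).symm.trans (V k).symm).trans (V (g * k))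
  have hY : ∀ x, Y x = V (g * k) ((V k).symm ((V g).symm x)) := fun _ => rfl
  obtain ⟨c, hc⟩ := hπ.exists_eq_smul_one (T := (Y.toContinuousLinearEquiv : F →L[ℂ] F))
    (fun a x => by
      change Y (π a x) = π a (Y x)
      obtain ⟨b, rfl⟩ : ∃ b, β g (β k b) = a :=
        ⟨β k⁻¹ (β g⁻¹ a), by rw [action_apply_inv_apply, action_apply_inv_apply]⟩
      rw [hY, hY, hVs, hVs, hV, CrossedProduct.map_mul_apply])
  refine ⟨c, fun x => ?_⟩
  have h1 := congrArg (fun Q : F →L[ℂ] F => Q (V g (V k x))) hc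
  change Y (V g (V k x)) = c • V g (V k x) at h1
  rw [← h1, hY]
  simp

end Stabilizer

section Disjoint

variable {A E F : Type*} [CStarAlgebra A]
  [NormedAddCommGroup E] [InnerProductSpace ℂ E] [CompleteSpace E]
  [NormedAddCommGroup F] [InnerProductSpace ℂ F] [CompleteSpace F]
  {π : A →⋆ₐ[ℂ] (E →L[ℂ] E)} {ρ : A →⋆ₐ[ℂ] (F →L[ℂ] F)}

theorem disjointReps_of_forall_eq_zero (h : ∀ X : E →L[ℂ] F, Intertwines π ρ X → X = 0) :
    DisjointReps π ρ := by
  rintro K L hK hL hKi hLi hK0 ⟨W, hW⟩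
  have := hK.completeSpace_coe
  let X : E →L[ℂ] F := L.subtypeL ∘L (W.toContinuousLinearEquiv : K →L[ℂ] L) ∘L
    K.orthogonalProjectionOnto
  have hX : ∀ x, X x = W (K.orthogonalProjectionOnto x) := fun _ => rfl
  have hX0 := h X fun a x => by
    rw [hX, hX, ← hW]
    congr 2
    exact Subtype.ext (intertwines_starProjection hKi a x)
  refine hK0 ((Submodule.eq_bot_iff _).2 fun x hx => ?_)
  have h1 : X x = 0 := by rw [hX0]; rfl
  rw [hX, K.orthogonalProjectionOnto_mem_subspace_eq_self ⟨x, hx⟩] at h1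
  have h2 : W ⟨x, hx⟩ = 0 := Subtype.ext h1
  have h3 := (map_eq_zero_iff W W.injective).1 h2
  exact congrArg Subtype.val h3

theorem not_unitarilyEquivalent_of_forall_eq_zero [Nontrivial E]
    (h : ∀ X : E →L[ℂ] F, Intertwines π ρ X → X = 0) : ¬ UnitarilyEquivalent π ρ := by
  rintro ⟨W, hW⟩
  obtain ⟨x, hx⟩ := exists_ne (0 : E)
  have h1 := h (W.toContinuousLinearEquiv : E →L[ℂ] F) hW
  have h2 : W x = 0 := congrArg (fun Q : E →L[ℂ] F => Q x) h1
  exact hx ((map_eq_zero_iff W W.injective).1 h2)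

end Disjoint

/-! ### Multiples of an irreducible representation -/

section Multiples

variable {G A E F : Type*} [Group G] [CStarAlgebra A]
  [NormedAddCommGroup E] [InnerProductSpace ℂ E] [CompleteSpace E]
  [NormedAddCommGroup F] [InnerProductSpace ℂ F] [CompleteSpace F]
  {α : G →* (A ≃⋆ₐ[ℂ] A)} {ρ : A →⋆ₐ[ℂ] (E →L[ℂ] E)} {u : G →* (E ≃ₗᵢ[ℂ] E)}
  {π₁ : A →⋆ₐ[ℂ] (F →L[ℂ] F)} {r : ℕ}
  {π : A →⋆ₐ[ℂ] (CTensor r F →L[ℂ] CTensor r F)}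

omit [CompleteSpace E] [CompleteSpace F] in
/-- Orthogonal isometric copies of `F` in `E` give an isometric copy of `ℂ ^ r ⊗ F`. -/
theorem exists_tensor_isometry (S : Fin r → F →ₗᵢ[ℂ] E)
    (hS : ∀ i j, i ≠ j → ∀ x y, inner ℂ (S i x) (S j y) = 0) :
    ∃ T : CTensor r F →ₗᵢ[ℂ] E, ∀ v y, T (v ⊗ₜ y) = ∑ i, v i • S i y := by
  obtain ⟨R, hR⟩ := exists_sum_isometry S hS
  obtain ⟨L, hL⟩ := exists_linearIsometryEquiv_piLp_tensor r F
  refine ⟨R.comp L.symm.toLinearIsometry, fun v y => ?_⟩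
  have h1 : v ⊗ₜ[ℂ] y = L (WithLp.toLp 2 fun i => v i • y) := by
    rw [hL]
    conv_lhs => rw [← (EuclideanSpace.basisFun (Fin r) ℂ).sum_repr v]
    simp [TensorProduct.sum_tmul, TensorProduct.smul_tmul]
  rw [h1]
  simp [hR]

theorem ContinuousLinearMap.tensor_ext {M : Type*} [NormedAddCommGroup M] [InnerProductSpace ℂ M]
    {D : Type*} [NormedAddCommGroup D] [InnerProductSpace ℂ D]
    {N : Type*} [NormedAddCommGroup N] [InnerProductSpace ℂ N] {X Y : (M ⊗[ℂ] D) →L[ℂ] N}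
    (h : ∀ v y, X (v ⊗ₜ y) = Y (v ⊗ₜ y)) : X = Y :=
  ContinuousLinearMap.coe_injective (TensorProduct.ext' h)

theorem eq_zero_of_tmul_eq_zero {M D : Type*} [NormedAddCommGroup M] [InnerProductSpace ℂ M]
    [NormedAddCommGroup D] [InnerProductSpace ℂ D] {v : M} {y : D} (hy : y ≠ 0)
    (h : v ⊗ₜ[ℂ] y = 0) : v = 0 := by
  have := congrArg norm h
  rw [TensorProduct.norm_tmul, norm_zero] at this
  exact norm_eq_zero.1 ((mul_eq_zero.1 this).resolve_right (norm_ne_zero_iff.2 hy))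

/-- Twists of `1 ⊗ π₁` by elements of different cosets of the stabilizer have no nonzero
intertwiner: its matrix coefficients intertwine twists of `π₁`. -/
theorem eq_zero_of_intertwines_twist (hπ₁ : IsIrreducibleRep π₁)
    (hπ : ∀ a v y, π a (v ⊗ₜ y) = v ⊗ₜ π₁ a y) {g k : G} (hgk : g * k⁻¹ ∉ repStabilizer π₁ α)
    {X : CTensor r F →L[ℂ] CTensor r F} (hX : Intertwines (twist π α g) (twist π α k) X) :
    X = 0 := by
  have hmk : ∀ v g, Intertwines (twist π₁ α g) (twist π α g)
      (TensorProduct.mkL ℂ (EuclideanSpace ℂ (Fin r)) F v) := fun v g a y => (hπ (α g a) v y).symm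
  refine ContinuousLinearMap.tensor_ext fun v y => ?_
  refine TensorProduct.ext_iff_inner_left.2 fun w z => ?_
  by_cases h0 : ContinuousLinearMap.adjoint (TensorProduct.mkL ℂ (EuclideanSpace ℂ (Fin r)) F w) ∘L
      X ∘L TensorProduct.mkL ℂ (EuclideanSpace ℂ (Fin r)) F v = 0
  · have h1 := congrArg (fun Q : F →L[ℂ] F => inner ℂ z (Q y)) h0
    simp only [ContinuousLinearMap.comp_apply, ContinuousLinearMap.adjoint_inner_right] at h1
    simpa using h1
  · exact absurd (mul_inv_mem_repStabilizer hπ₁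
      ((hmk w k).adjoint.comp (hX.comp (hmk v g))) h0) hgk

/-- Translates of an isotypic component by elements outside the stabilizer are orthogonal to
it. -/
theorem inner_translate_eq_zero (hcov : ∀ g a x, u g (ρ a x) = ρ (α g a) (u g x))
    (hπ₁ : IsIrreducibleRep π₁) (hπ : ∀ a v y, π a (v ⊗ₜ y) = v ⊗ₜ π₁ a y)
    {T : CTensor r F →ₗᵢ[ℂ] E} (hT : Intertwines π ρ T.toContinuousLinearMap) {g : G}
    (hg : g ∉ repStabilizer π₁ α) (x y : CTensor r F) : inner ℂ (T x) (u g (T y)) = 0 := by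
  let X : CTensor r F →L[ℂ] CTensor r F := ContinuousLinearMap.adjoint T.toContinuousLinearMap ∘L
    ((u g).toContinuousLinearEquiv : E →L[ℂ] E) ∘L T.toContinuousLinearMap
  have hX : Intertwines (twist π α 1) (twist π α g) X := by
    intro a z
    have h1 : twist π α 1 a = π a := by rw [twist_apply, map_one]; rfl
    rw [h1, twist_apply]
    refine Eq.trans ?_ (hT.adjoint (α g a) (u g (T z)))
    rw [← hcov]
    exact congrArg (fun w => ContinuousLinearMap.adjoint T.toContinuousLinearMap (u g w)) (hT a z)
  have h0 : X = 0 := eq_zero_of_intertwines_twist hπ₁ hπ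
    (by rwa [one_mul, inv_mem_iff]) hX
  have h1 := congrArg (fun Q : CTensor r F →L[ℂ] CTensor r F => inner ℂ x (Q y)) h0
  simp only [X, ContinuousLinearMap.comp_apply, ContinuousLinearMap.adjoint_inner_right] at h1
  simpa using h1

/-- A unitary `w` that implements an automorphism `β` and preserves an isotypic component acts on
it as `Λ ⊗ V`, where `V` implements `β` on the irreducible representation. -/
theorem exists_tensor_factor (hπ₁ : IsIrreducibleRep π₁) {S : Fin r → F →ₗᵢ[ℂ] E}
    (hS : ∀ i, Intertwines π₁ ρ (S i).toContinuousLinearMap)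
    (hspan : ∀ X : F →L[ℂ] E, Intertwines π₁ ρ X → ∃ c : Fin r → ℂ, ∀ y, X y = ∑ i, c i • S i y)
    {T : CTensor r F →ₗᵢ[ℂ] E} (hT : ∀ v y, T (v ⊗ₜ y) = ∑ i, v i • S i y)
    {β : A ≃⋆ₐ[ℂ] A} {V : F ≃ₗᵢ[ℂ] F} (hV : ∀ a y, V (π₁ a y) = π₁ (β a) (V y))
    {w : E ≃ₗᵢ[ℂ] E} (hw : ∀ a x, w (ρ a x) = ρ (β a) (w x)) :
    ∃ Λ : EuclideanSpace ℂ (Fin r) ≃ₗᵢ[ℂ] EuclideanSpace ℂ (Fin r),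
      ∀ v y, w (T (v ⊗ₜ y)) = T (Λ v ⊗ₜ V y) := by
  have hVs : ∀ a y, V.symm (π₁ (β a) y) = π₁ a (V.symm y) := fun a y => by
    rw [LinearIsometryEquiv.symm_apply_eq, hV, LinearIsometryEquiv.apply_symm_apply]
  have hX : ∀ j, ∃ c : Fin r → ℂ, ∀ y, w (S j (V.symm y)) = ∑ i, c i • S i y := by
    intro j
    refine hspan ((w.toContinuousLinearEquiv : E →L[ℂ] E) ∘L (S j).toContinuousLinearMap ∘L
      (V.symm.toContinuousLinearEquiv : F →L[ℂ] F)) fun a y => ?_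
    obtain ⟨b, rfl⟩ := β.surjective a
    change w (S j (V.symm (π₁ (β b) y))) = ρ (β b) (w (S j (V.symm y)))
    rw [hVs, ← hw]
    exact congrArg w (hS j b (V.symm y))
  choose c hc using hX
  let L : EuclideanSpace ℂ (Fin r) →ₗ[ℂ] EuclideanSpace ℂ (Fin r) :=
    { toFun := fun v => WithLp.toLp 2 fun i => ∑ j, v j * c j i
      map_add' := fun v v' => by
        ext i; simp [add_mul, Finset.sum_add_distrib]
      map_smul' := fun t v => by
        ext i; simp [Finset.mul_sum, mul_assoc] }
  have hL : ∀ v y, w (T (v ⊗ₜ y)) = T (L v ⊗ₜ V y) := by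
    intro v y
    rw [hT, hT, map_sum]
    have h1 : ∀ j, w (v j • S j y) = ∑ i, (v j * c j i) • S i (V y) := by
      intro j
      have := hc j (V y)
      rw [V.symm_apply_apply] at this
      rw [map_smul, this, Finset.smul_sum]
      simp only [smul_smul]
    simp only [h1]
    rw [Finset.sum_comm]
    refine Finset.sum_congr rfl fun i _ => ?_
    rw [← Finset.sum_smul]
    rfl
  have := hπ₁.1
  obtain ⟨y, hy⟩ := exists_ne (0 : F)
  have hnorm : ∀ v, ‖L v‖ = ‖v‖ := by
    intro v
    have h1 := congrArg norm (hL v y)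
    rw [w.norm_map, T.norm_map, T.norm_map, TensorProduct.norm_tmul, TensorProduct.norm_tmul,
      V.norm_map] at h1
    exact (mul_right_cancel₀ (norm_ne_zero_iff.2 hy) h1).symm
  exact ⟨LinearIsometry.toLinearIsometryEquiv ⟨L, hnorm⟩ rfl, hL⟩

/-- If `Λ ⊗ V` and `1 ⊗ π₁` form an irreducible representation, then `Λ` is irreducible: the
orthogonal complement of `L ⊗ F` is invariant whenever `L` is. -/
theorem isIrreducibleSet_of_tensor [Finite G] [Nontrivial F] (hr : 0 < r)
    {Ψ : CrossedProduct α →⋆ₐ[ℂ] (CTensor r F →L[ℂ] CTensor r F)} (hΨ : IsIrreducibleRep Ψ)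
    (hι : ∀ a v y, Ψ (CrossedProduct.ι α a) (v ⊗ₜ y) = v ⊗ₜ π₁ a y)
    {Λ : G → (EuclideanSpace ℂ (Fin r) →L[ℂ] EuclideanSpace ℂ (Fin r))} {V : G → (F →L[ℂ] F)}
    (hU : ∀ g v y, Ψ (CrossedProduct.U α g : CrossedProduct α) (v ⊗ₜ y) = Λ g v ⊗ₜ V g y) :
    IsIrreducibleSet (Set.range Λ) := by
  have : Nonempty (Fin r) := ⟨⟨0, hr⟩⟩
  obtain ⟨y₀, hy₀⟩ := exists_ne (0 : F)
  refine ⟨inferInstance, fun L _ hinv => ?_⟩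
  let X : Set (CTensor r F) := {z | ∃ v ∈ L, ∃ y : F, z = v ⊗ₜ y}
  have hmem : ∀ b, ∀ z ∈ Submodule.span ℂ X, Ψ b z ∈ Submodule.span ℂ X := by
    intro b z hz
    refine CrossedProduct.apply_mem_of_generators Ψ (fun a z hz => ?_) (fun g z hz => ?_) b hz
    · have : Submodule.span ℂ X ≤ (Submodule.span ℂ X).comap
          (Ψ (CrossedProduct.ι α a)).toLinearMap := by
        refine Submodule.span_le.2 ?_
        rintro _ ⟨v, hv, y, rfl⟩
        exact Submodule.subset_span ⟨v, hv, π₁ a y, hι a v y⟩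
      exact this hz
    · have : Submodule.span ℂ X ≤ (Submodule.span ℂ X).comap
          (Ψ (CrossedProduct.U α g : CrossedProduct α)).toLinearMap := by
        refine Submodule.span_le.2 ?_
        rintro _ ⟨v, hv, y, rfl⟩
        exact Submodule.subset_span ⟨Λ g v, hinv _ ⟨g, rfl⟩ v hv, V g y, hU g v y⟩
      exact this hz
  rcases hΨ.2 (Submodule.span ℂ X)ᗮ (Submodule.isClosed_orthogonal _) (by
    rintro _ ⟨b, rfl⟩ z hz
    exact mem_orthogonal_of_invariant hmem b hz) with h | h
  · right
    refine (Submodule.orthogonal_eq_bot_iff).1 ((Submodule.eq_bot_iff _).2 fun v hv => ?_)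
    have h1 : v ⊗ₜ[ℂ] y₀ ∈ (Submodule.span ℂ X)ᗮ := by
      refine Submodule.mem_orthogonal_span_iff.2 ?_
      rintro _ ⟨w, hw, y, rfl⟩
      rw [TensorProduct.inner_tmul, (Submodule.mem_orthogonal _ _).1 hv w hw, zero_mul]
    rw [h, Submodule.mem_bot] at h1
    exact eq_zero_of_tmul_eq_zero hy₀ h1
  · left
    refine (Submodule.eq_bot_iff _).2 fun v hv => ?_
    have h1 : v ⊗ₜ[ℂ] y₀ ∈ (Submodule.span ℂ X)ᗮ := by rw [h]; trivial
    exact eq_zero_of_tmul_eq_zero hy₀ (inner_self_eq_zero.1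
      (Submodule.mem_orthogonal_span_iff.1 h1 _ ⟨v, hv, y₀, rfl⟩))

end Multiples

/-! ### Decomposition over the cosets -/

section Cosets

variable {G A E D : Type*} [Group G] [CStarAlgebra A]
  [NormedAddCommGroup E] [InnerProductSpace ℂ E] [CompleteSpace E]
  [NormedAddCommGroup D] [InnerProductSpace ℂ D] [CompleteSpace D]
  {α : G →* (A ≃⋆ₐ[ℂ] A)} {ρ : A →⋆ₐ[ℂ] (E →L[ℂ] E)} {u : G →* (E ≃ₗᵢ[ℂ] E)}
  {H : Subgroup G} {T : D →ₗᵢ[ℂ] E}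

theorem IsRightCosetReps.mul_inv_notMem {I : Type*} {g : I → G} (hg : IsRightCosetReps H g)
    {i j : I} (hij : i ≠ j) : g i * (g j)⁻¹ ∉ H := fun hmem =>
  Set.disjoint_left.1 (hg.1 hij) ⟨1, H.one_mem, (one_mul _).symm⟩
    ⟨_, hmem, by rw [inv_mul_cancel_right]⟩

theorem IsRightCosetReps.exists_eq_mul {I : Type*} {g : I → G} (hg : IsRightCosetReps H g)
    (x : G) : ∃ (i : I) (h : H), x = h * g i := by
  have hx : x ∈ ⋃ i, {x | ∃ h ∈ H, x = h * g i} := by rw [hg.2]; trivial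
  obtain ⟨i, h, hh, hx⟩ := Set.mem_iUnion.1 hx
  exact ⟨i, ⟨h, hh⟩, hx⟩

/-- If the translates of `D` by elements outside `H` are orthogonal to `D`, then `H` acts
irreducibly on `D`: the translates of an invariant subspace span an invariant subspace. -/
theorem IsIrreducibleCovariantPair.isIrreducibleRep_subgroup [Finite G] [Nontrivial D]
    (h : IsIrreducibleCovariantPair α ρ u)
    (hort : ∀ g ∉ H, ∀ x y, inner ℂ (T x) (u g (T y)) = 0)
    {Ψ : CrossedProduct (α.comp H.subtype) →⋆ₐ[ℂ] (D →L[ℂ] D)}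
    (hι : ∀ a z, T (Ψ (CrossedProduct.ι _ a) z) = ρ a (T z))
    (hU : ∀ (k : H) z, T (Ψ (CrossedProduct.U (α.comp H.subtype) k :
      CrossedProduct (α.comp H.subtype)) z) = u k (T z)) : IsIrreducibleRep Ψ := by
  refine ⟨inferInstance, fun K hK hinv => ?_⟩
  by_cases hK0 : K = ⊥
  · exact Or.inl hK0
  right
  have := hK.completeSpace_coe
  obtain ⟨z₀, hz₀, hz₀'⟩ := (Submodule.ne_bot_iff _).1 hK0
  refine (Submodule.orthogonal_eq_bot_iff).1 ((Submodule.eq_bot_iff _).2 fun z hz => ?_)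
  have hTz : T z = 0 := by
    refine h.eq_zero_of_orthogonal (X := {x | ∃ g, ∃ y ∈ K, x = u g (T y)}) (x₀ := T z₀) ?_ ?_
      ⟨1, z₀, hz₀, (map_one_isometry_apply u _).symm⟩ ?_ ?_
    · rintro a _ ⟨g, y, hy, rfl⟩
      refine ⟨g, Ψ (CrossedProduct.ι _ (α g⁻¹ a)) y, hinv _ ⟨_, rfl⟩ y hy, ?_⟩
      rw [hι, h.covariant, action_apply_inv_apply]
    · rintro k _ ⟨g, y, hy, rfl⟩
      exact ⟨k * g, y, hy, (map_mul_isometry_apply u k g _).symm⟩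
    · exact fun h0 => hz₀' ((map_eq_zero_iff T T.injective).1 h0)
    · rintro _ ⟨g, y, hy, rfl⟩
      by_cases hg : g ∈ H
      · have h1 := hU ⟨g, hg⟩ y
        dsimp only at h1
        rw [← h1, T.inner_map_map]
        exact (Submodule.mem_orthogonal _ _).1 hz _ (hinv _ ⟨_, rfl⟩ y hy)
      · exact inner_eq_zero_symm.1 (hort g hg z y)
  exact (map_eq_zero_iff T T.injective).1 hTz

/-- If the translates of `D` by elements outside `H` are orthogonal to `D`, then `E` is the
orthogonal sum of the translates of `D` over the right cosets of `H`, and the group permutes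
them. -/
theorem IsIrreducibleCovariantPair.exists_coset_decomposition [Finite G] [Nontrivial D]
    (h : IsIrreducibleCovariantPair α ρ u) {π : A →⋆ₐ[ℂ] (D →L[ℂ] D)}
    (hT : Intertwines π ρ T.toContinuousLinearMap)
    (hort : ∀ g ∉ H, ∀ x y, inner ℂ (T x) (u g (T y)) = 0)
    {Ψ : CrossedProduct (α.comp H.subtype) →⋆ₐ[ℂ] (D →L[ℂ] D)}
    (hU : ∀ (k : H) z, T (Ψ (CrossedProduct.U (α.comp H.subtype) k :
      CrossedProduct (α.comp H.subtype)) z) = u k (T z))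
    {I : Type*} [Fintype I] [DecidableEq I] {g : I → G} {i₀ : I} (hi₀ : g i₀ = 1)
    (hg : IsRightCosetReps H g) :
    ∃ W : E ≃ₗᵢ[ℂ] PiLp 2 (fun _ : I => D),
      (∀ i y, W (u (g i)⁻¹ (T y)) = PiLp.single 2 i y) ∧
      (∀ a x i, W (ρ a x) i = twist π α (g i) a (W x i)) ∧
      ∃ (σ : G → Equiv.Perm I) (v : G → I → unitary (D →L[ℂ] D)),
        (∀ k x i, W (u k x) i = ∑ j, if i = σ k j then (v k j : D →L[ℂ] D) (W x j) else 0) ∧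
        (∀ k, k ∈ H ↔ σ k i₀ = i₀) ∧
        (∀ k : H, (v k i₀ : D →L[ℂ] D) = Ψ (CrossedProduct.U (α.comp H.subtype) k :
          CrossedProduct (α.comp H.subtype))) := by
  obtain ⟨R, hR⟩ := exists_sum_isometry (fun i => (u (g i)⁻¹).toLinearIsometry.comp T)
    (fun i j hij x y => by
      change inner ℂ (u (g i)⁻¹ (T x)) (u (g j)⁻¹ (T y)) = 0
      rw [inner_isometry_apply_left, inv_inv, ← map_mul_isometry_apply]
      exact hort _ (hg.mul_inv_notMem hij) x y)
  replace hR : ∀ y, R y = ∑ i, u (g i)⁻¹ (T (y i)) := hR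
  have hRsingle : ∀ i y, R (PiLp.single 2 i y) = u (g i)⁻¹ (T y) := by
    intro i y
    rw [hR, Finset.sum_eq_single i]
    · simp
    · intro j _ hj; simp [hj]
    · simp
  have hTρ : ∀ a z, ρ a (T z) = T (π a z) := fun a z => (hT a z).symm
  have hRρ : ∀ a y, ρ a (R y) = R (WithLp.toLp 2 fun i => π (α (g i) a) (y i)) := by
    intro a y
    rw [hR, hR, map_sum]
    refine Finset.sum_congr rfl fun i _ => ?_
    rw [← hTρ, h.covariant, action_inv_apply_apply]
  -- `k` sends the translate at `g j` to the one at `g (s k j)`, where `g j k⁻¹ ∈ H g (s k j)`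
  choose s t hst using fun (k : G) (j : I) => hg.exists_eq_mul (g j * k⁻¹)
  have hinj : ∀ k, Function.Injective (s k) := by
    intro k i j hij
    by_contra hne
    refine hg.mul_inv_notMem hne ?_
    have h1 : g i * (g j)⁻¹ = t k i * (t k j : G)⁻¹ := by
      have h2 : g i = t k i * g (s k i) * k := by rw [← hst, inv_mul_cancel_right]
      have h3 : g j = t k j * g (s k i) * k := by rw [hij, ← hst, inv_mul_cancel_right]
      rw [h2, h3]
      group
    rw [h1]
    exact H.mul_mem (t k i).2 (H.inv_mem (t k j).2)
  let σ : G → Equiv.Perm I := fun k => Equiv.ofBijective (s k)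
    (Finite.injective_iff_bijective.1 (hinj k))
  have hσ : ∀ k j, σ k j = s k j := fun _ _ => rfl
  let v : G → I → unitary (D →L[ℂ] D) := fun k j =>
    ⟨Ψ (CrossedProduct.U (α.comp H.subtype) (t k j)⁻¹ : CrossedProduct (α.comp H.subtype)),
      Unitary.map_mem Ψ (CrossedProduct.U (α.comp H.subtype) (t k j)⁻¹).2⟩
  have huv : ∀ k j z, u k (u (g j)⁻¹ (T z)) = u (g (σ k j))⁻¹ (T ((v k j : D →L[ℂ] D) z)) := by
    intro k j z
    change _ = u (g (s k j))⁻¹ (T (Ψ (CrossedProduct.U (α.comp H.subtype) (t k j)⁻¹ :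
      CrossedProduct (α.comp H.subtype)) z))
    rw [hU, ← map_mul_isometry_apply, ← map_mul_isometry_apply]
    have h1 := congrArg (·⁻¹) (hst k j)
    simp only [mul_inv_rev, inv_inv] at h1
    rw [h1]
    rfl
  have hRu : ∀ k y, u k (R y) = R (WithLp.toLp 2 fun i =>
      ∑ j, if i = σ k j then (v k j : D →L[ℂ] D) (y j) else 0) := by
    intro k y
    rw [hR, hR, map_sum]
    refine Eq.trans (Finset.sum_congr rfl fun j _ => ?_)
      (Equiv.sum_comp (σ k) fun i => u (g i)⁻¹ (T (∑ j,
        if i = σ k j then (v k j : D →L[ℂ] D) (y j) else 0)))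
    rw [huv]
    simp
  have hsurj : Function.Surjective R := by
    have hcl : IsClosed (LinearMap.range R.toLinearMap : Set E) := by
      have := R.isometry.isClosedEmbedding.isClosed_range
      rwa [← LinearIsometry.coe_toLinearMap, ← LinearMap.coe_range] at this
    rcases h.eq_bot_or_eq_top (LinearMap.range R.toLinearMap) hcl
      (by rintro a _ ⟨y, rfl⟩; exact ⟨_, (hRρ a y).symm⟩)
      (by rintro k _ ⟨y, rfl⟩; exact ⟨_, (hRu k y).symm⟩) with h0 | h0
    · obtain ⟨z, hz⟩ := exists_ne (0 : D)
      have h1 : R (PiLp.single 2 i₀ z) ∈ LinearMap.range R.toLinearMap := ⟨_, rfl⟩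
      rw [h0, Submodule.mem_bot, hRsingle, hi₀, inv_one, map_one_isometry_apply] at h1
      exact absurd ((map_eq_zero_iff T T.injective).1 h1) hz
    · intro x
      have : x ∈ LinearMap.range R.toLinearMap := by rw [h0]; trivial
      exact this
  let W := (LinearIsometryEquiv.ofSurjective R hsurj).symm
  have hWR : ∀ y, W (R y) = y := fun y =>
    (LinearIsometryEquiv.ofSurjective R hsurj).symm_apply_apply y
  refine ⟨W, fun i y => by rw [← hRsingle, hWR], fun a x i => ?_, σ, v, fun k x i => ?_,
    fun k => ?_, fun k => ?_⟩
  · obtain ⟨y, rfl⟩ := hsurj x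
    rw [hRρ, hWR, hWR, twist_apply]
  · obtain ⟨y, rfl⟩ := hsurj x
    rw [hRu, hWR, hWR]
  · rw [hσ]
    have h1 := hst k i₀
    rw [hi₀, one_mul] at h1
    constructor
    · intro hk
      by_contra hne
      refine hg.mul_inv_notMem hne ?_
      rw [hi₀, inv_one, mul_one, ← inv_mul_eq_iff_eq_mul.2 h1]
      exact H.mul_mem (H.inv_mem (t k i₀).2) (H.inv_mem hk)
    · intro hs
      rw [hs, hi₀, mul_one] at h1
      rw [← inv_mem_iff, h1]
      exact (t k i₀).2
  · have hs : s k i₀ = i₀ := by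
      by_contra hne
      have h1 := hst k i₀
      rw [hi₀, one_mul] at h1
      refine hg.mul_inv_notMem hne ?_
      rw [hi₀, inv_one, mul_one, ← inv_mul_eq_iff_eq_mul.2 h1]
      exact H.mul_mem (H.inv_mem (t k i₀).2) (H.inv_mem k.2)
    have h1 := hst k i₀
    rw [hs, hi₀, one_mul, mul_one] at h1
    have h2 : (t k i₀)⁻¹ = k := by
      rw [inv_eq_iff_eq_inv]
      exact Subtype.ext h1.symm
    change Ψ (CrossedProduct.U (α.comp H.subtype) (t k i₀)⁻¹ :
      CrossedProduct (α.comp H.subtype)) = _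
    rw [h2]

end Cosets

/-! ### Structure of the irreducible representations of the crossed product -/

theorem mainTheorem1 {G : Type u} [Group G] [Finite G] {A : Type v} [CStarAlgebra A]
    (α : G →* (A ≃⋆ₐ[ℂ] A))
    {E : Type w} [NormedAddCommGroup E] [InnerProductSpace ℂ E] [CompleteSpace E]
    (P : CrossedProduct α →⋆ₐ[ℂ] (E →L[ℂ] E)) (hP : IsIrreducibleRep P) :
    ∃ (H : Subgroup G) (H₁ : Type w) (_ : NormedAddCommGroup H₁) (_ : InnerProductSpace ℂ H₁)
      (_ : CompleteSpace H₁) (r : ℕ) (π₁ : A →⋆ₐ[ℂ] (H₁ →L[ℂ] H₁))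
      (π : A →⋆ₐ[ℂ] (CTensor r H₁ →L[ℂ] CTensor r H₁))
      (V : H → unitary (H₁ →L[ℂ] H₁))
      (Λ : H → unitary (EuclideanSpace ℂ (Fin r) →L[ℂ] EuclideanSpace ℂ (Fin r)))
      (Ψ : CrossedProduct (α.comp H.subtype) →⋆ₐ[ℂ]
        (CTensor r H₁ →L[ℂ] CTensor r H₁))
      (T : G → (CTensor r H₁ →ₗᵢ[ℂ] E)),
      -- `π = 1 ⊗ π₁` with `π₁` irreducible, and `H` is the stabilizer of the class of `π₁`
      IsIrreducibleRep π₁ ∧ 0 < r ∧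
      (∀ a, π a = ContinuousLinearMap.lTensor (EuclideanSpace ℂ (Fin r)) (π₁ a)) ∧
      (∀ g, g ∈ H ↔ UnitarilyEquivalent (twist π₁ α g) π₁) ∧
      -- the projective representation `V` of `H`
      IsUnitaryProjectiveRep V ∧
      (∀ h a, (V h : H₁ →L[ℂ] H₁) * π₁ a * star (V h : H₁ →L[ℂ] H₁) = π₁ (α h a)) ∧
      -- the irreducible projective representation `Λ` of `H`
      IsUnitaryProjectiveRep Λ ∧
      IsIrreducibleSet (Set.range fun h =>
        (Λ h : EuclideanSpace ℂ (Fin r) →L[ℂ] EuclideanSpace ℂ (Fin r))) ∧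
      -- the irreducible representation `Ψ` of `A ⋊ H`
      IsIrreducibleRep Ψ ∧
      (∀ a, Ψ (CrossedProduct.ι _ a) = π a) ∧
      (∀ h, Ψ (CrossedProduct.U (α.comp H.subtype) h : CrossedProduct (α.comp H.subtype)) =
        TensorProduct.mapL (Λ h : EuclideanSpace ℂ (Fin r) →L[ℂ] EuclideanSpace ℂ (Fin r))
          (V h : H₁ →L[ℂ] H₁)) ∧
      -- for every system of coset representatives containing the neutral element:
      ∀ (g : Fin H.index → G) (i₀ : Fin H.index), g i₀ = 1 → IsRightCosetReps H g →
        (∀ i j, i ≠ j → DisjointReps (twist π α (g i)) (twist π α (g j)) ∧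
          ¬ UnitarilyEquivalent (twist π α (g i)) (twist π α (g j))) ∧
        -- `E` is the orthogonal direct sum of the copies `T (g i)` of the space of `π`
        ∃ W : E ≃ₗᵢ[ℂ] PiLp 2 (fun _ : Fin H.index => CTensor r H₁),
          (∀ i y, W (T (g i) y) = PiLp.single 2 i y) ∧
          (∀ a x i, W (P (CrossedProduct.ι α a) x) i = twist π α (g i) a (W x i)) ∧
          ∃ (σ : G → Equiv.Perm (Fin H.index))
            (u : G → Fin H.index → unitary (CTensor r H₁ →L[ℂ] CTensor r H₁)),
            (∀ k x i, W (P (CrossedProduct.U α k : CrossedProduct α) x) i =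
              ∑ j, if i = σ k j then (u k j : CTensor r H₁ →L[ℂ] CTensor r H₁) (W x j) else 0) ∧
            (∀ k, k ∈ H ↔ σ k i₀ = i₀) ∧
            (∀ h : H, (u h i₀ : CTensor r H₁ →L[ℂ] CTensor r H₁) =
              Ψ (CrossedProduct.U (α.comp H.subtype) h : CrossedProduct (α.comp H.subtype))) := by
  let ρ : A →⋆ₐ[ℂ] (E →L[ℂ] E) := P.comp (CrossedProduct.ι α)
  let U : G →* (E ≃ₗᵢ[ℂ] E) := CrossedProduct.unitaryPart P
  have h : IsIrreducibleCovariantPair α ρ U := CrossedProduct.isIrreducibleCovariantPair hP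
  -- a minimal closed invariant subspace carries the irreducible representation `π₁`
  obtain ⟨M, hM, hMinv, hM0, hMmin⟩ := h.exists_minimal_subspace
  have := hM.completeSpace_coe
  obtain ⟨π₁, hπ₁S⟩ := exists_compression ρ M.subtypeₗᵢ
    (fun a x => ⟨⟨ρ a x, hMinv a x x.2⟩, rfl⟩)
  have hπ₁ : IsIrreducibleRep π₁ := by
    refine ⟨Submodule.nontrivial_iff_ne_bot.2 hM0, fun K hK hinv => ?_⟩
    have hcl : IsClosed ((K.map M.subtype : Submodule ℂ E) : Set E) := by
      rw [Submodule.map_coe]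
      exact (hM.isClosedEmbedding_subtypeVal).isClosedMap _ hK
    rcases hMmin (K.map M.subtype) hcl (by
      rintro a _ ⟨x, hx, rfl⟩
      exact ⟨π₁ a x, hinv _ ⟨a, rfl⟩ x hx, hπ₁S a x⟩) (Submodule.map_subtype_le M K) with h0 | h0
    · refine Or.inl ((Submodule.eq_bot_iff _).2 fun x hx => ?_)
      have hx' : (x : E) ∈ K.map M.subtype := ⟨x, hx, rfl⟩
      rw [h0, Submodule.mem_bot] at hx'
      exact Subtype.ext hx'
    · right
      refine (Submodule.eq_top_iff').2 fun x => ?_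
      have hx : (x : E) ∈ K.map M.subtype := by rw [h0]; exact x.2
      obtain ⟨y, hy, hyx⟩ := hx
      rwa [← Subtype.ext hyx]
  have := hπ₁.1
  -- the isotypic component of `π₁` is the range of `T₁`
  obtain ⟨r, S, hr, hS, hSort, hspan⟩ := h.exists_orthogonal_basis_intertwiners hπ₁ hπ₁S
  obtain ⟨T₁, hT₁⟩ := exists_tensor_isometry S hSort
  have hTρ : ∀ a z, ρ a (T₁ z) =
      T₁ (ContinuousLinearMap.lTensor (EuclideanSpace ℂ (Fin r)) (π₁ a) z) := by
    intro a z
    have h1 : ρ a ∘L T₁.toContinuousLinearMap = T₁.toContinuousLinearMap ∘L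
        ContinuousLinearMap.lTensor (EuclideanSpace ℂ (Fin r)) (π₁ a) := by
      refine ContinuousLinearMap.tensor_ext fun v y => ?_
      change ρ a (T₁ _) = T₁ (v ⊗ₜ π₁ a y)
      rw [hT₁, hT₁, map_sum]
      refine Finset.sum_congr rfl fun i _ => ?_
      rw [map_smul]
      exact congrArg _ (hS i a y).symm
    exact congrArg (fun Q : CTensor r M →L[ℂ] E => Q z) h1
  obtain ⟨π, hπT⟩ := exists_compression ρ T₁ fun a z => ⟨_, hTρ a z⟩
  have hπ : ∀ a, π a = ContinuousLinearMap.lTensor (EuclideanSpace ℂ (Fin r)) (π₁ a) := by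
    intro a
    ext1 z
    exact T₁.injective ((hπT a z).trans (hTρ a z))
  have hπtmul : ∀ a v y, π a (v ⊗ₜ y) = v ⊗ₜ π₁ a y := fun a v y => by rw [hπ]; rfl
  -- `V` implements the action of `H` on `H₁`, and `Λ` is the remaining tensor factor of `U`
  let H : Subgroup G := repStabilizer π₁ α
  have hVex : ∀ k : H, ∃ V : M ≃ₗᵢ[ℂ] M, ∀ a y, V (π₁ a y) = π₁ (α k a) (V y) := by
    rintro ⟨k, W, hW⟩
    exact ⟨W.symm, fun a y => by
      rw [LinearIsometryEquiv.symm_apply_eq, ← twist_apply, hW,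
        LinearIsometryEquiv.apply_symm_apply]⟩
  choose V hV using hVex
  choose Λ hΛ using fun k : H => exists_tensor_factor hπ₁ hS hspan hT₁ (β := α k) (hV k)
    (w := U k) (h.covariant k)
  have hVmul : ∀ g k : H, ∃ c : ℂ, ∀ y, V (g * k) y = c • V g (V k y) :=
    exists_smul_of_implementing (β := α.comp H.subtype) hπ₁ hV
  have hΛmul : ∀ g k : H, ∃ c : ℂ, ∀ v, Λ (g * k) v = c • Λ g (Λ k v) := by
    intro g k
    obtain ⟨c, hc⟩ := hVmul g k
    obtain ⟨y, hy⟩ := exists_ne (0 : M)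
    have hc0 : c ≠ 0 := by
      rintro rfl
      have h1 := hc y
      rw [zero_smul] at h1
      exact hy ((map_eq_zero_iff _ (V (g * k)).injective).1 h1)
    refine ⟨c⁻¹, fun v => ?_⟩
    have h1 : T₁ (Λ (g * k) v ⊗ₜ V (g * k) y) = T₁ (Λ g (Λ k v) ⊗ₜ V g (V k y)) := by
      rw [← hΛ, ← hΛ, ← hΛ, Subgroup.coe_mul, map_mul_isometry_apply]
    replace h1 := T₁.injective h1
    rw [hc, TensorProduct.tmul_smul, TensorProduct.smul_tmul', ← sub_eq_zero,
      ← TensorProduct.sub_tmul] at h1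
    have h2 := eq_zero_of_tmul_eq_zero (by
      rw [← norm_ne_zero_iff, LinearIsometryEquiv.norm_map, LinearIsometryEquiv.norm_map]
      exact norm_ne_zero_iff.2 hy) h1
    rw [← sub_eq_zero.1 h2, inv_smul_smul₀ hc0]
  let V' : H → unitary (M →L[ℂ] M) := fun k => Unitary.linearIsometryEquiv.symm (V k)
  let Λ' : H → unitary (EuclideanSpace ℂ (Fin r) →L[ℂ] EuclideanSpace ℂ (Fin r)) :=
    fun k => Unitary.linearIsometryEquiv.symm (Λ k)
  have hUT : ∀ (k : H) z, U k (T₁ z) = T₁ (TensorProduct.mapL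
      (Λ' k : EuclideanSpace ℂ (Fin r) →L[ℂ] EuclideanSpace ℂ (Fin r)) (V' k : M →L[ℂ] M) z) := by
    intro k z
    have h1 : ((U k).toContinuousLinearEquiv : E →L[ℂ] E) ∘L T₁.toContinuousLinearMap =
        T₁.toContinuousLinearMap ∘L TensorProduct.mapL
          (Λ' k : EuclideanSpace ℂ (Fin r) →L[ℂ] EuclideanSpace ℂ (Fin r))
          (V' k : M →L[ℂ] M) :=
      ContinuousLinearMap.tensor_ext fun v y => hΛ k v y
    exact congrArg (fun Q : CTensor r M →L[ℂ] E => Q z) h1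
  -- `Ψ` is the restriction to the isotypic component of the representation of `A ⋊ H` on `E`
  obtain ⟨PH, hPHι, hPHU⟩ := CrossedProduct.exists_of_covariant (α := α.comp H.subtype) (ρ := ρ)
    (u := U.comp H.subtype) (fun k a x => h.covariant k a x)
  obtain ⟨Ψ, hΨT⟩ := exists_compression PH T₁ (by
    intro b z
    obtain ⟨y, hy⟩ := CrossedProduct.apply_mem_of_generators PH
      (K := LinearMap.range T₁.toLinearMap)
      (by rintro a _ ⟨z, rfl⟩; exact ⟨_, (hTρ a z).symm.trans (by rw [hPHι]; rfl)⟩)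
      (by rintro k _ ⟨z, rfl⟩; exact ⟨_, (hUT k z).symm.trans (by rw [hPHU]; rfl)⟩) b
      (x := T₁ z) ⟨z, rfl⟩
    exact ⟨y, hy.symm⟩)
  have hΨι : ∀ a z, T₁ (Ψ (CrossedProduct.ι _ a) z) = ρ a (T₁ z) := fun a z =>
    (hΨT _ z).trans (by rw [hPHι]; rfl)
  have hΨU : ∀ (k : H) z, T₁ (Ψ (CrossedProduct.U (α.comp H.subtype) k :
      CrossedProduct (α.comp H.subtype)) z) = U k (T₁ z) := fun k z =>
    (hΨT _ z).trans (by rw [hPHU]; rfl)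
  have hΨι' : ∀ a, Ψ (CrossedProduct.ι _ a) = π a := fun a => by
    ext1 z
    exact T₁.injective ((hΨι a z).trans (hπT a z).symm)
  have hΨU' : ∀ k : H, Ψ (CrossedProduct.U (α.comp H.subtype) k :
      CrossedProduct (α.comp H.subtype)) = TensorProduct.mapL
      (Λ' k : EuclideanSpace ℂ (Fin r) →L[ℂ] EuclideanSpace ℂ (Fin r)) (V' k : M →L[ℂ] M) :=
    fun k => by
      ext1 z
      exact T₁.injective ((hΨU k z).trans (hUT k z))
  have hort : ∀ g ∉ H, ∀ x y, inner ℂ (T₁ x) (U g (T₁ y)) = 0 := fun g hg x y =>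
    inner_translate_eq_zero h.covariant hπ₁ hπtmul hπT hg x y
  have : Nonempty (Fin r) := ⟨⟨0, hr⟩⟩
  -- `ℂ ^ r ⊗ H₁` is nonzero because `r > 0`
  have : Nontrivial (CTensor r M) := by
    obtain ⟨y, hy⟩ := exists_ne (0 : M)
    obtain ⟨v, hv⟩ := exists_ne (0 : EuclideanSpace ℂ (Fin r))
    exact ⟨v ⊗ₜ y, 0, fun h0 => hv (eq_zero_of_tmul_eq_zero hy h0)⟩
  have hΨ : IsIrreducibleRep Ψ := h.isIrreducibleRep_subgroup hort hΨι hΨU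
  refine ⟨H, M, inferInstance, inferInstance, inferInstance, r, π₁, π, V', Λ', Ψ,
    fun g => (U g⁻¹).toLinearIsometry.comp T₁, hπ₁, hr, hπ, fun g => mem_repStabilizer,
    isUnitaryProjectiveRep_of_exists_smul fun g k => ?_, fun k a => ?_,
    isUnitaryProjectiveRep_of_exists_smul fun g k => ?_,
    isIrreducibleSet_of_tensor hr hΨ (fun a v y => by rw [hΨι', hπtmul])
      (V := fun k => (V' k : M →L[ℂ] M)) (fun k v y => by rw [hΨU']; rfl),
    hΨ, hΨι', hΨU', fun g i₀ hi₀ hg => ⟨fun i j hij => ?_, ?_⟩⟩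
  · obtain ⟨c, hc⟩ := hVmul g k
    exact ⟨c, ContinuousLinearMap.ext hc⟩
  · have h1 : (V' k : M →L[ℂ] M) * π₁ a = π₁ (α k a) * (V' k : M →L[ℂ] M) :=
      ContinuousLinearMap.ext fun y => hV k a y
    rw [h1, mul_assoc, Unitary.mul_star_self_of_mem (V' k).2, mul_one]
  · obtain ⟨c, hc⟩ := hΛmul g k
    exact ⟨c, ContinuousLinearMap.ext hc⟩
  · have h0 := fun X => eq_zero_of_intertwines_twist (X := X) hπ₁ hπtmul
      (hg.mul_inv_notMem hij)
    exact ⟨disjointReps_of_forall_eq_zero h0, not_unitarilyEquivalent_of_forall_eq_zero h0⟩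
  · exact h.exists_coset_decomposition hπT hort hΨU hi₀ hg
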